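/- Let $N\ge 1$, let $A=(A[i][j])_{0\le i,j<N}$ be an $N\times N$ array of real numbers, and let $0<\epsilon<1$. Consider the following quantum algorithm *subarray-sum* with parameter $\epsilon^{-1}$. 1. Build a table $T$ with $T[i][j]=0$ if $i<0$ or $j<0$ by $T[i][j]=A[i][j]+(T[i-1][j]+T[i][j-1]-T[i-1][j-1])$ for $i=0,\dots,N-1$ and, for each $i$, $j=0,\dots,N-1$. 2. Run *minfind* with parameter $\epsilon^{-1}$ on the set of the $N^4$ quadruples $(miny,minx,maxy,maxx)\in\{0,\dots,N-1\}^4$, to minimize minus the subarray sum $T[maxy][maxx]-T[maxy][minx-1]-T[miny-1][maxx]+T[miny-1][minx-1]$ (with the value $\infty$ at quadruples with $miny>maxy$ or $minx>maxx$, which do not describe a rectangle), and return the result. Here, for a function $F$ on a finite nonempty set $X$: * *minfind* picks $y\in X$ uniformly at random and repeats: run *findsol* for the condition $F(y')<F(y)$ on $y'$; if it returns an element $y'$, replace $y$ by $y'$, otherwise return $y$. * *findsol* runs *BBHT* up to twice and then *BCWZ* with parameter $\epsilon^{-1}$, until a solution is found; if none is found, it returns *false*. * *BBHT* starts with $m=1$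 and, while $m\le 2\sqrt{|X|}$, chooses an integer $0\le j<m$ uniformly at random, executes Grover's algorithm with $j$ iterations, measures, returns the outcome if it is a solution, and otherwise multiplies $m$ by $8/7$. * *BCWZ* with $t_0=\lceil\lg\epsilon^{-1}\rceil$ executes, for $t=1,\dots,\min(t_0,|X|)$, the version of Grover's algorithm that succeeds with certainty if there are exactly $t$ solutions, and then, if $t_0<|X|$, $3t_0$ times Grover's algorithm with a uniformly random number $0\le j<\sqrt{|X|/t_0}$ of iterations, until a solution is found. Time is the number of elementary steps: each operation of arithmetic, comparison, array access, random choice, preparation or measurement of a register takes one step, a Grover iteration takes one query plus a constant number of steps, and a query to a condition in superposition takes twice the worst-case time of computing the condition plus one step. Then, with probability at least $1-\epsilon$, the algorithm returns the limits $(miny,minx,maxy,maxx)$ of a rectangular subarray of $A$ (that is, $miny\le maxy$ and $minx\le maxx$) whose sum $\sum_{i=miny}^{maxy}\sum_{j=minx}^{maxx}A[i][j]$ is the largest among all rectangular subarrays of $A$; and its expected running time is $O(N^2\sqrt{\lg\epsilon^{-1}})$: there is an absolute constant $C$ such that it is at most $C N^2\sqrt{\max(1,\lg\epsilon^{-1})}$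 for all $N\ge 1$, all $A$ and all $0<\epsilon<1$. -/

import Mathlib

noncomputable section

/-! ## Computations with a step count -/

/-- A deterministic computation: its result and the number of elementary steps it takes. -/
structure Timed (α : Type) where
  val : α
  time : ℕ

instance : Monad Timed where
  pure a := ⟨a, 0⟩
  bind c f := ⟨(f c.val).val, c.time + (f c.val).time⟩

/-- One elementary operation with result `a`: an operation of (exact real or integer) arithmetic or
logic, a comparison, the evaluation of a fixed elementary formula in a few numbers, or one access
to an array cell. -/
def op {α : Type} (a : α) : Timed α := ⟨a, 1⟩

/-- A computation with random outcome: the joint distribution of its result and of the number of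
elementary steps it takes. -/
def Comp (α : Type) : Type := PMF (Timed α)

instance : Monad Comp where
  pure a := PMF.pure ⟨a, 0⟩
  bind c f := PMF.bind c fun o => PMF.map (fun o' => ⟨o'.val, o.time + o'.time⟩) (f o.val)

/-- The probability that the result of a computation lies in `S`. -/
def Comp.prob {α : Type} (c : Comp α) (S : Set α) : ENNReal :=
  PMF.toOuterMeasure c {o | o.val ∈ S}

/-- The expected number of elementary steps of a computation. -/
def Comp.expectedTime {α : Type} (c : Comp α) : ENNReal :=
  ∑' o : Timed α, (show PMF (Timed α) from c) o * (o.time : ENNReal)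

/-- Run a deterministic computation. -/
def Comp.run {α : Type} (c : Timed α) : Comp α := PMF.pure c

/-- Draw from a distribution in a given number of steps. -/
def Comp.draw {α : Type} (p : PMF α) (steps : ℕ) : Comp α := PMF.map (fun a => ⟨a, steps⟩) p

/-- Run `c`, and test (in one step) whether it returned *false* (`none`). -/
def Comp.tested {β : Type} (c : Comp (Option β)) : Comp (Option β) := do
  let o ← c
  Comp.run (op o)

/-- Run `c`; if it returns *false*, run `d`. -/
def Comp.orElse {β : Type} (c d : Comp (Option β)) : Comp (Option β) := do
  match ← c.tested with
  | some b => pure (some b)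
  | none => d

/-- Run `c` up to `n` times, until it returns something else than *false*. -/
def Comp.retry {β : Type} (c : Comp (Option β)) : ℕ → Comp (Option β)
  | 0 => pure none
  | n + 1 => c.orElse (c.retry n)

/-- An integer `j` with `0 ≤ j < m`, that is, `j ≤ ⌈m⌉ - 1`, chosen uniformly at random in one step
(for real `m ≥ 1`). -/
def randBelow (m : ℝ) : Comp ℕ :=
  Comp.draw ((PMF.uniformOfFintype (Fin (⌈m⌉₊ - 1 + 1))).map Fin.val) 1

/-! ## Quantum states, Grover iterations, measurement -/

/-- The pure states of a register with computational basis `Y`: the unit vectors of `ℂ^Y`. -/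
abbrev PureState (Y : Type) [Fintype Y] : Type :=
  {ψ : EuclideanSpace ℂ Y // ‖ψ‖ = 1}

theorem sum_ofReal_norm_sq {Y : Type} [Fintype Y] (ψ : PureState Y) :
    ∑ y, ENNReal.ofReal (‖ψ.1 y‖ ^ 2) = 1 := by
  rw [← ENNReal.ofReal_sum_of_nonneg (fun _ _ => by positivity), ← EuclideanSpace.norm_sq_eq,
    ψ.2]
  simp

/-- Measurement in the computational basis (Born rule). -/
def measureBasis {Y : Type} [Fintype Y] (ψ : PureState Y) : PMF Y :=
  PMF.ofFintype (fun y => ENNReal.ofReal (‖ψ.1 y‖ ^ 2)) (sum_ofReal_norm_sq ψ)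

/-- The phase oracle of `S`: `|y⟩ ↦ -|y⟩` if `S y`, and `|y⟩ ↦ |y⟩` otherwise. -/
def phaseOracle {Y : Type} [Fintype Y] (S : Y → Bool) :
    EuclideanSpace ℂ Y ≃ₗᵢ[ℂ] EuclideanSpace ℂ Y :=
  LinearIsometryEquiv.piLpCongrRight 2
    (fun y => if S y then LinearIsometryEquiv.neg ℂ else LinearIsometryEquiv.refl ℂ ℂ)

/-- One Grover iteration with start state `s`: the phase oracle, followed by the reflection
`2|s⟩⟨s| - 1`. -/
def groverIteration {Y : Type} [Fintype Y] (s : PureState Y) (S : Y → Bool) :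
    EuclideanSpace ℂ Y ≃ₗᵢ[ℂ] EuclideanSpace ℂ Y :=
  (phaseOracle S).trans (Submodule.reflection (Submodule.span ℂ {s.1}))

/-- The state after `j` Grover iterations. -/
def groverState {Y : Type} [Fintype Y] (s : PureState Y) (S : Y → Bool) (j : ℕ) : PureState Y :=
  ⟨(groverIteration s S ^ j) s.1, by rw [LinearIsometryEquiv.norm_map, s.2]⟩

/-- The number of steps of one application of the phase oracle of a predicate that is computed by
`P`: compute it on the whole superposition (which takes as long as its slowest branch), flip the
phase, and undo the computation. -/
def queryTime {Y : Type} [Fintype Y] (P : Y → Timed Bool) : ℕ :=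
  2 * (Finset.univ.sup fun y => (P y).time) + 1

/-- Prepare `s` (one step), execute `j` Grover iterations for the predicate `P` (in each one, a
query to `P` and three steps for the reflection: undo the preparation, flip a phase, prepare
again), and measure (one step). -/
def amplify {Y : Type} [Fintype Y] (s : PureState Y) (P : Y → Timed Bool) (j : ℕ) : Comp Y :=
  Comp.draw (measureBasis (groverState s (fun y => (P y).val) j)) (1 + j * (queryTime P + 3) + 1)

section Search

variable {X : Type} [Fintype X] [Nonempty X]

/-- The uniform superposition on `X`, tensored with the qubit `cos a |0⟩ + sin a |1⟩`. -/
def tiltedState (X : Type) [Fintype X] [Nonempty X] (a : ℝ) : PureState (X × Bool) :=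
  ⟨WithLp.toLp 2 fun z =>
      (((1 / √(Fintype.card X : ℝ)) * (if z.2 then Real.sin a else Real.cos a) : ℝ) : ℂ), by
    have hc : (Fintype.card X : ℝ) ≠ 0 := by exact_mod_cast Fintype.card_ne_zero
    have hs : (√(Fintype.card X : ℝ)) ^ 2 = Fintype.card X := Real.sq_sqrt (by positivity)
    rw [← sq_eq_sq₀ (norm_nonneg _) zero_le_one, EuclideanSpace.norm_sq_eq,
      Fintype.sum_prod_type]
    simp only [Complex.norm_real, Real.norm_eq_abs, sq_abs, Fintype.sum_bool, mul_pow, div_pow, hs,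
      ← mul_add, if_true, Bool.false_eq_true, if_false, Real.sin_sq_add_cos_sq, Finset.sum_const,
      Finset.card_univ, nsmul_eq_mul]
    field_simp⟩

/-- The uniform superposition on `X`. -/
def uniformState (X : Type) [Fintype X] [Nonempty X] : PureState X :=
  ⟨WithLp.toLp 2 fun _ => ((1 / √(Fintype.card X : ℝ) : ℝ) : ℂ), by
    have hc : (Fintype.card X : ℝ) ≠ 0 := by exact_mod_cast Fintype.card_ne_zero
    have hs : (√(Fintype.card X : ℝ)) ^ 2 = Fintype.card X := Real.sq_sqrt (by positivity)
    rw [← sq_eq_sq₀ (norm_nonneg _) zero_le_one, EuclideanSpace.norm_sq_eq]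
    simp only [Complex.norm_real, Real.norm_eq_abs, sq_abs, div_pow, hs, Finset.sum_const,
      Finset.card_univ, nsmul_eq_mul]
    field_simp⟩

/-- The solutions of the binary function computed by `P`. -/
abbrev Solution (P : X → Timed Bool) : Type := {x : X // (P x).val = true}

/-- Evaluate `P` at `x`; return `x` if it is a solution and *false* otherwise. -/
def check (P : X → Timed Bool) (x : X) : Comp (Option (Solution P)) :=
  Comp.run ⟨if h : (P x).val = true then some ⟨x, h⟩ else none, (P x).time + 1⟩

/-- Choose an integer `0 ≤ j < m` uniformly at random, execute Grover's algorithm with `j`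
iterations, and return the outcome if it is a solution. -/
def randomGrover (P : X → Timed Bool) (m : ℝ) : Comp (Option (Solution P)) := do
  let j ← randBelow m
  let x ← amplify (uniformState X) P j
  check P x

/-! ### BBHT -/

/-- `n` rounds of the loop of *BBHT*, the first one with parameter `m`, which is multiplied by
`8 / 7` (and compared with `2 √|X|`) after every unsuccessful round. -/
def bbhtLoop (P : X → Timed Bool) : ℕ → ℝ → Comp (Option (Solution P))
  | 0, _ => pure none
  | n + 1, m => (randomGrover P m).orElse do
      let m' ← Comp.run (op (8 / 7 * m))
      let _continue ← Comp.run (op (decide (m' ≤ 2 * √(Fintype.card X : ℝ))))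
      bbhtLoop P n m'

/-- *BBHT*: the loop is entered with `m = 1` and is repeated while `m ≤ 2 √|X|`, that is, for
`m = (8 / 7) ^ k` with `0 ≤ k ≤ log (2 √|X|) / log (8 / 7)`. -/
def bbht (P : X → Timed Bool) : Comp (Option (Solution P)) :=
  bbhtLoop P (⌊Real.logb (8 / 7) (2 * √(Fintype.card X : ℝ))⌋₊ + 1) 1

/-! ### BCWZ -/

/-- The number of iterations in the exact search for `t` solutions: the least `k ≥ 0` with
`(2 k + 1) θ ≥ π / 2`, where `sin θ = √(t / |X|)`. -/
def exactIterations (X : Type) [Fintype X] (t : ℕ) : ℕ :=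
  ⌈(Real.pi / (2 * Real.arcsin √((t : ℝ) / Fintype.card X)) - 1) / 2⌉₊

/-- The angle of the auxiliary qubit in the exact search for `t` solutions: it lowers the amplitude
`sin θ = √(t / |X|)` of the solutions to `sin (π / (4 k + 2))`, so that `k` iterations rotate the
state exactly onto them. -/
def exactAngle (X : Type) [Fintype X] (t : ℕ) : ℝ :=
  Real.arcsin (Real.sin (Real.pi / (4 * exactIterations X t + 2)) /
    √((t : ℝ) / Fintype.card X))

/-- Search that succeeds with certainty if there are exactly `t` solutions. -/
def exactSearch (P : X → Timed Bool) (t : ℕ) : Comp (Option (Solution P)) := do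
  let k ← Comp.run (op (exactIterations X t))
  let a ← Comp.run (op (exactAngle X t))
  let z ← amplify (tiltedState X a) (fun z => do let b ← P z.1; op (b && z.2)) k
  check P z.1

/-- Exact searches for `1, 2, …, n` solutions, until one of them succeeds. -/
def exactSearches (P : X → Timed Bool) : ℕ → Comp (Option (Solution P))
  | 0 => pure none
  | n + 1 => (exactSearches P n).orElse (exactSearch P (n + 1))

/-- *BCWZ* with parameter `einv = 1 / ε`: with `t₀ = ⌈lg einv⌉`, search exactly for `1, …, t₀`
solutions; if this fails (and there can be more than `t₀` solutions), execute `O(t₀)` times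
Grover's algorithm with a random number of at most `√(|X| / t₀)` iterations. -/
def bcwz (P : X → Timed Bool) (einv : ℝ) : Comp (Option (Solution P)) := do
  let t₀ ← Comp.run (op ⌈Real.logb 2 einv⌉₊)
  (exactSearches P (min t₀ (Fintype.card X))).orElse
    (if t₀ < Fintype.card X then
      (randomGrover P √((Fintype.card X : ℝ) / t₀)).retry (3 * t₀)
    else pure none)

/-! ### The tools findsol and minfind -/

/-- *findsol* with parameter `einv = 1 / ε`: run *BBHT* up to twice, and then *BCWZ*. -/
def findsol (P : X → Timed Bool) (einv : ℝ) : Comp (Option (Solution P)) :=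
  ((bbht P).retry 2).orElse (bcwz P einv)

variable {R : Type} [LinearOrder R]

/-- The computation of the binary function `x ↦ (F x < F y)`. -/
def isBetter (F : X → Timed R) (y x : X) : Timed Bool := do
  let w ← F x
  let v ← F y
  op (decide (w < v))

/-- The loop of *minfind*: replace `y` by some `y'` with `F y' < F y` until *findsol* returns
*false*; then return `y`. -/
def minfindLoop (F : X → Timed R) (einv : ℝ) (y : X) : Comp X := do
  match ← (findsol (isBetter F y) einv).tested with
  | some ⟨y', h⟩ =>
      have _better : (F y').val < (F y).val := of_decide_eq_true h
      minfindLoop F einv y'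
  | none => pure y
termination_by (Finset.univ.filter fun x => (F x).val < (F y).val).card
decreasing_by
  apply Finset.card_lt_card
  rw [Finset.ssubset_iff_of_subset]
  · exact ⟨y', by simpa using _better, by simp⟩
  · intro x hx
    simp only [Finset.mem_filter, Finset.mem_univ, true_and] at hx ⊢
    exact hx.trans _better

/-- *minfind* with parameter `einv = 1 / ε`: start the loop at a random element. -/
def minfind (F : X → Timed R) (einv : ℝ) : Comp X := do
  let y ← Comp.draw (PMF.uniformOfFintype X) 1
  minfindLoop F einv y

end Search

/-! ## The maximum subarray sum -/

/-- The limits `(miny, minx, maxy, maxx)` of a subarray of an `N × N` array; there are `N ^ 4`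
such quadruples. -/
abbrev Limits (N : ℕ) : Type := Fin N × Fin N × Fin N × Fin N

/-- The limits describe a (nonempty) rectangular subarray. -/
def IsRectangle {N : ℕ} : Limits N → Prop
  | (miny, minx, maxy, maxx) => miny ≤ maxy ∧ minx ≤ maxx

/-- The sum of the elements of a subarray. -/
def subarraySumOf {N : ℕ} (A : Fin N → Fin N → ℝ) : Limits N → ℝ
  | (miny, minx, maxy, maxx) => ∑ i ∈ Finset.Icc miny maxy, ∑ j ∈ Finset.Icc minx maxx, A i j

/-- The limits describe a rectangular subarray whose sum is maximal. -/
def IsMaxSubarray {N : ℕ} (A : Fin N → Fin N → ℝ) (r : Limits N) : Prop :=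
  IsRectangle r ∧ ∀ r' : Limits N, IsRectangle r' → subarraySumOf A r' ≤ subarraySumOf A r

/-- Fill in `T[i][j] = A[i][j] + (T[i-1][j] + T[i][j-1] - T[i-1][j-1])`. -/
def fillCell {N : ℕ} (A : Fin N → Fin N → ℝ) (i j : Fin N) (T : ℤ → ℤ → ℝ) :
    Timed (ℤ → ℤ → ℝ) := do
  let i' ← op ((i : ℤ) - 1)
  let j' ← op ((j : ℤ) - 1)
  let a ← op (A i j)
  let up ← op (T i' j)
  let left ← op (T i j')
  let diag ← op (T i' j')
  let s ← op (up + left)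
  let d ← op (s - diag)
  let v ← op (a + d)
  op fun p q => if p = i ∧ q = j then v else T p q

/-- The construction of the table `T`, which has rows and columns `-1, 0, …, N - 1` and is
initialized to `0` (in `(N + 1) ^ 2` steps). Each pass of each of the two loops takes one further
step for its counter. -/
def buildTable {N : ℕ} (A : Fin N → Fin N → ℝ) : Timed (ℤ → ℤ → ℝ) := do
  let T₀ ← (⟨fun _ _ => 0, (N + 1) ^ 2⟩ : Timed (ℤ → ℤ → ℝ))
  (List.finRange N).foldlM (fun T i => do
    let i ← op i
    (List.finRange N).foldlM (fun T j => do
      let j ← op j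
      fillCell A i j T) T) T₀

/-- The function to be minimized: minus the sum over the subarray, computed from the table, where
quadruples that do not describe a rectangle get the value `∞`. -/
def negSum {N : ℕ} (T : ℤ → ℤ → ℝ) : Limits N → Timed (WithTop ℝ)
  | (miny, minx, maxy, maxx) => do
    let by_ ← op (decide (miny ≤ maxy))
    let bx ← op (decide (minx ≤ maxx))
    let b ← op (by_ && bx)
    if b then do
      let y' ← op ((miny : ℤ) - 1)
      let x' ← op ((minx : ℤ) - 1)
      let t₁ ← op (T maxy maxx)
      let t₂ ← op (T maxy x')
      let t₃ ← op (T y' maxx)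
      let t₄ ← op (T y' x')
      let s₁ ← op (t₁ - t₂)
      let s₂ ← op (s₁ - t₃)
      let s₃ ← op (s₂ + t₄)
      op ((-s₃ : ℝ) : WithTop ℝ)
    else op ⊤

/-- The algorithm *subarray-sum* with parameter `einv = 1 / ε`: build the table, and *minfind* over
all quadruples of limits. -/
def subarraySum {N : ℕ} [NeZero N] (A : Fin N → Fin N → ℝ) (einv : ℝ) : Comp (Limits N) := do
  let T ← Comp.run (buildTable A)
  minfind (negSum T) einv

end

/-! Time and error are handled by one functional: `Comp.cost w c g` charges `w` per step and `g` on
the result. With `w = 1`, `g = 0` it is the expected time; with `w = 0` and an indicator it is a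
probability.

By symmetry, each search that succeeds returns a uniformly random solution. `SearchBound` records
this together with a time and a failure bound, and is closed under sequential composition, so the
whole search routine is assembled from single Grover runs. Grover's algorithm with `t` solutions is
a rotation with `sin θ = √(t / |X|)` (`groverState_apply`), and a random number of iterations below
some `M ≥ 1 / sin θ` succeeds with probability at least `1 / 4` (`quarter_le_sum_sin_sq`). Hence
BBHT takes `O(√(|X| / t))` expected steps and fails with probability at most `1 / (2 t)`. BCWZ costs
`O(√(|X| lg ε⁻¹))` and fails with probability at most `ε`, but it is reached only after two failures
of BBHT. So *findsol* costs `O(√(|X| lg ε⁻¹ / t))` and errs with probability at most `ε / (4 t ^ 2)`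
(`searchBound_findsol_of_pos`).

In *minfind*, `t` is the rank of the current element, and the next element is uniform among the `t`
better ones. The error terms `ε / (4 t ^ 2)` sum to at most `ε` even if every rank is visited. For
the time, the bounded potential `2 - 1 / √(t + 1)` drops on average by at least `1 / (6 √(t + 1))`,
which pays for one call of *findsol*, so the total is `O(√(|X| lg ε⁻¹))`. Here `|X| = N ^ 4`, and
the table of prefix sums, built in `O(N ^ 2)` steps, makes each evaluation take constant time. -/

noncomputable section

open scoped ENNReal

/-! ### Expectations and costs of computations -/

/-- The expectation of an extended nonnegative function. -/
def PMF.expect {α : Type} (p : PMF α) (h : α → ℝ≥0∞) : ℝ≥0∞ := ∑' a, p a * h a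

theorem PMF.expect_pure {α : Type} (a : α) (h : α → ℝ≥0∞) : (PMF.pure a).expect h = h a := by
  unfold PMF.expect
  rw [tsum_eq_single a]
  · simp
  · intro b hb
    simp [hb]

theorem PMF.expect_bind {α β : Type} (p : PMF α) (f : α → PMF β) (h : β → ℝ≥0∞) :
    (p.bind f).expect h = p.expect fun a => (f a).expect h := by
  unfold PMF.expect
  simp only [PMF.bind_apply, ← ENNReal.tsum_mul_right, ← ENNReal.tsum_mul_left]
  rw [ENNReal.tsum_comm]
  simp only [mul_assoc]

theorem PMF.expect_map {α β : Type} (p : PMF α) (f : α → β) (h : β → ℝ≥0∞) :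
    (p.map f).expect h = p.expect fun a => h (f a) := by
  rw [← PMF.bind_pure_comp, PMF.expect_bind]
  simp [PMF.expect_pure]

theorem PMF.expect_const_add {α : Type} (p : PMF α) (c : ℝ≥0∞) (h : α → ℝ≥0∞) :
    (p.expect fun a => c + h a) = c + p.expect h := by
  unfold PMF.expect
  simp only [mul_add, ENNReal.tsum_add, ENNReal.tsum_mul_right, p.tsum_coe, one_mul]

theorem PMF.expect_mono {α : Type} (p : PMF α) {h k : α → ℝ≥0∞} (hk : ∀ a, h a ≤ k a) :
    p.expect h ≤ p.expect k :=
  ENNReal.tsum_le_tsum fun a => mul_le_mul_right (hk a) _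

theorem PMF.expect_le {α : Type} (p : PMF α) {h : α → ℝ≥0∞} {c : ℝ≥0∞} (hc : ∀ a, h a ≤ c) :
    p.expect h ≤ c := by
  refine (p.expect_mono hc).trans ?_
  unfold PMF.expect
  rw [ENNReal.tsum_mul_right, p.tsum_coe, one_mul]

theorem PMF.expect_fintype {α : Type} [Fintype α] (p : PMF α) (h : α → ℝ≥0∞) :
    p.expect h = ∑ a, p a * h a := tsum_fintype _

/-- The expected cost of a computation, where each step costs `w` and the result `a` costs
`g a`. -/
def Comp.cost {α : Type} (w : ℝ≥0∞) (c : Comp α) (g : α → ℝ≥0∞) : ℝ≥0∞ :=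
  PMF.expect c fun o => w * o.time + g o.val

namespace Comp

variable {α β : Type} (w : ℝ≥0∞)

theorem cost_pure (a : α) (g : α → ℝ≥0∞) : cost w (pure a : Comp α) g = g a := by
  refine (PMF.expect_pure _ _).trans ?_
  simp

/-- Since steps add up and are charged linearly, the cost of the continuation acts as a terminal
cost for the first computation. This turns every later analysis into backward substitution. -/
theorem cost_bind (c : Comp α) (f : α → Comp β) (g : β → ℝ≥0∞) :
    cost w (c >>= f) g = cost w c fun a => cost w (f a) g := by
  refine (PMF.expect_bind _ _ _).trans ?_
  refine congrArg (PMF.expect c) (funext fun o => ?_)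
  refine (PMF.expect_map (α := Timed β) (f o.val) _ _).trans ?_
  refine Eq.trans ?_ (PMF.expect_const_add (α := Timed β) (f o.val) _ _)
  refine congrArg (PMF.expect _) (funext fun o' => ?_)
  push_cast
  ring

theorem cost_run (c : Timed α) (g : α → ℝ≥0∞) : cost w (run c) g = w * c.time + g c.val :=
  PMF.expect_pure _ _

theorem cost_run_op (a : α) (g : α → ℝ≥0∞) : cost w (run (op a)) g = w + g a := by
  rw [cost_run]
  simp [op]

theorem cost_draw (p : PMF α) (n : ℕ) (g : α → ℝ≥0∞) :
    cost w (draw p n) g = w * n + p.expect g := by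
  refine (PMF.expect_map _ _ _).trans ?_
  exact PMF.expect_const_add p (w * n) g

theorem cost_const_add (c : Comp α) (b : ℝ≥0∞) (g : α → ℝ≥0∞) :
    (cost w c fun a => b + g a) = b + cost w c g := by
  refine Eq.trans ?_ (PMF.expect_const_add (α := Timed α) c _ _)
  refine congrArg (PMF.expect _) (funext fun o => ?_)
  ring

theorem expectedTime_eq_cost (c : Comp α) : c.expectedTime = cost 1 c fun _ => 0 := by
  unfold expectedTime cost PMF.expect
  simp

theorem prob_eq_cost (c : Comp α) (S : Set α) : c.prob S = cost 0 c (S.indicator 1) := by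
  unfold prob cost PMF.expect
  refine (PMF.toOuterMeasure_apply (α := Timed α) c _).trans ?_
  refine tsum_congr fun o => ?_
  by_cases h : o.val ∈ S <;> simp [h]

theorem cost_tested (c : Comp (Option β)) (g : Option β → ℝ≥0∞) :
    cost w c.tested g = cost w c fun o => w + g o := by
  unfold tested
  rw [cost_bind]
  simp only [cost_run_op]

theorem cost_orElse (c d : Comp (Option β)) (g : Option β → ℝ≥0∞) :
    cost w (c.orElse d) g =
      cost w c fun o => w + o.elim (cost w d g) fun b => g (some b) := by
  unfold orElse
  rw [cost_bind, cost_tested]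
  congr 1
  funext o
  cases o
  · rfl
  · simp only [Option.elim_some]
    rw [cost_pure]

end Comp

/-! ### The calculus of searches with uniformly random output -/

section Search

variable {X : Type} [Fintype X]

/-- The mean of a function over the solutions (and `0` if there are none). -/
def solutionMean (P : X → Timed Bool) (g : Option (Solution P) → ℝ≥0∞) : ℝ≥0∞ :=
  (∑ x : Solution P, g (some x)) / (Fintype.card (Solution P) : ℝ≥0∞)

/-- `c` returns a uniformly random solution or *false*; the latter has probability at most `p`, and
the expected number of steps is at most `T`. (If there is no solution, then *false* is certain.) -/
def SearchBound (P : X → Timed Bool) (c : Comp (Option (Solution P))) (T p : ℝ) : Prop :=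
  ∀ (w : ℝ≥0∞) (g : Option (Solution P) → ℝ≥0∞) (d : ℝ≥0∞), g none ≤ solutionMean P g + d →
    c.cost w g ≤ w * ENNReal.ofReal T + solutionMean P g + ENNReal.ofReal p * d

variable {P : X → Timed Bool} {c d : Comp (Option (Solution P))} {T T' p p' : ℝ}

theorem SearchBound.mono (h : SearchBound P c T p) (hT : T ≤ T') (hp : p ≤ p') :
    SearchBound P c T' p' := fun w g e he =>
  (h w g e he).trans (by gcongr)

theorem searchBound_pure_none : SearchBound P (pure none) 0 1 := fun w g e he => by
  rw [Comp.cost_pure]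
  simpa using he

theorem card_solution_ne_zero_of [Nonempty (Solution P)] :
    (Fintype.card (Solution P) : ℝ≥0∞) ≠ 0 := by
  exact_mod_cast Fintype.card_ne_zero

/-- The second search is absorbed into the value of `none` for the first one. Its excess over the
mean is then `w * T' + p' * e`, which is weighted by the failure probability `p`; the extra step is
the test for *false*. -/
theorem SearchBound.orElse (hc : SearchBound P c T p) (hd : SearchBound P d T' p')
    (hT : 0 ≤ T) (hp : 0 ≤ p) (hT' : 0 ≤ T') :
    SearchBound P (c.orElse d) (T + 1 + p * T') (p * p') := fun w g e he => by
  rw [Comp.cost_orElse]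
  set g' : Option (Solution P) → ℝ≥0∞ := fun o => o.elim (d.cost w g) fun b => g (some b)
  have hm : solutionMean P g' = solutionMean P g := rfl
  have h1 : c.cost w (fun o => w + g' o) = w + c.cost w g' := Comp.cost_const_add w c w g'
  have h2 := hc w g' (w * ENNReal.ofReal T' + ENNReal.ofReal p' * e) (by
    rw [hm]
    refine (hd w g e he).trans (le_of_eq ?_)
    ring)
  change c.cost w (fun o => w + g' o) ≤ _
  rw [h1, ENNReal.ofReal_add (by positivity) (by positivity), ENNReal.ofReal_add hT zero_le_one,
    ENNReal.ofReal_mul hp, ENNReal.ofReal_mul hp, ENNReal.ofReal_one]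
  rw [hm] at h2
  refine (add_le_add_right h2 w).trans (le_of_eq ?_)
  ring

theorem SearchBound.retry (hc : SearchBound P c T p) (hT : 0 ≤ T) (hp : 0 ≤ p) (hp1 : p ≤ 1)
    (n : ℕ) : SearchBound P (c.retry n) (n * (T + 1)) (p ^ n) := by
  induction n with
  | zero => simpa [Comp.retry] using searchBound_pure_none
  | succ n ih =>
    refine (hc.orElse ih hT hp (by positivity)).mono ?_ (by rw [pow_succ'])
    push_cast
    nlinarith [mul_le_mul_of_nonneg_right hp1 (by positivity : 0 ≤ (n : ℝ) * (T + 1))]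

theorem SearchBound.run_op_bind {α : Type} {a : α} {f : α → Comp (Option (Solution P))}
    (h : SearchBound P (f a) T p) (hT : 0 ≤ T) :
    SearchBound P (Comp.run (op a) >>= f) (T + 1) p := fun w g e he => by
  rw [Comp.cost_bind, Comp.cost_run_op, ENNReal.ofReal_add hT zero_le_one, ENNReal.ofReal_one]
  refine (add_le_add_right (h w g e he) w).trans (le_of_eq ?_)
  ring

/-- A random choice between finitely many searches. -/
theorem SearchBound.draw_map_bind {α β : Type} [Fintype α] (D : PMF α) (v : α → β) (n : ℕ)
    {f : β → Comp (Option (Solution P))} {q : α → ℝ} (h : ∀ a, SearchBound P (f (v a)) T (q a))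
    (hT : 0 ≤ T) (hp : ∑ a, D a * ENNReal.ofReal (q a) ≤ ENNReal.ofReal p) :
    SearchBound P (Comp.draw (D.map v) n >>= f) (T + n) p := fun w g e he => by
  rw [Comp.cost_bind, Comp.cost_draw, PMF.expect_map, ENNReal.ofReal_add hT (by positivity),
    ENNReal.ofReal_natCast]
  have h1 : D.expect (fun a => (f (v a)).cost w g) ≤
      (w * ENNReal.ofReal T + solutionMean P g) + D.expect fun a => ENNReal.ofReal (q a) * e := by
    rw [← PMF.expect_const_add]
    exact D.expect_mono fun a => h a w g e he
  have h2 : D.expect (fun a => ENNReal.ofReal (q a) * e) ≤ ENNReal.ofReal p * e := by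
    rw [PMF.expect_fintype]
    simp only [← mul_assoc]
    rw [← Finset.sum_mul]
    gcongr
  calc _ ≤ w * n + ((w * ENNReal.ofReal T + solutionMean P g) + ENNReal.ofReal p * e) := by
        gcongr
        exact h1.trans (by gcongr)
    _ = _ := by ring

end Search

/-! ### Amplitudes under Grover iterations -/

section Grover

variable {Y : Type} [Fintype Y]

theorem groverIteration_apply (s : PureState Y) (S : Y → Bool) (ψ : EuclideanSpace ℂ Y) (y : Y) :
    groverIteration s S ψ y =
      2 * inner ℂ s.1 (phaseOracle S ψ) * s.1 y - (if S y then -ψ y else ψ y) := by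
  unfold groverIteration
  rw [LinearIsometryEquiv.trans_apply, Submodule.reflection_apply,
    Submodule.starProjection_unit_singleton ℂ s.2]
  have h : phaseOracle S ψ y = if S y then -ψ y else ψ y := by
    unfold phaseOracle
    rw [LinearIsometryEquiv.piLpCongrRight_apply]
    by_cases hy : S y <;> simp [hy]
  simp only [PiLp.sub_apply, PiLp.smul_apply, h, smul_eq_mul, two_smul,
    PiLp.add_apply]
  ring

/-- After `j` Grover iterations, the amplitudes of the start state are rescaled by one factor on the
marked basis states, and by another one on the rest. -/
theorem groverState_apply {s : PureState Y} {S : Y → Bool} {r : Y → ℝ} {θ : ℝ}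
    (hr : ∀ y, s.1 y = (r y : ℂ)) (hθ : ∑ y with S y = true, r y ^ 2 = Real.sin θ ^ 2) (j : ℕ) :
    -- The factors are specified without division, so that `sin θ = 0` and `cos θ = 0` need no
    -- separate treatment.
    ∃ α β : ℝ, α * Real.sin θ = Real.sin ((2 * j + 1) * θ) ∧
      β * Real.cos θ = Real.cos ((2 * j + 1) * θ) ∧
      ∀ y, (groverState s S j).1 y = (((if S y then α else β) * r y : ℝ) : ℂ) := by
  induction j with
  | zero => exact ⟨1, 1, by simp, by simp, fun y => by simp [groverState, hr]⟩
  | succ j ih =>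
    obtain ⟨α, β, hα, hβ, h⟩ := ih
    have hθ' : ∑ y with ¬ S y = true, r y ^ 2 = Real.cos θ ^ 2 := by
      have h1 : ∑ y, r y ^ 2 = 1 := by
        have h2 := EuclideanSpace.norm_sq_eq s.1
        rw [s.2] at h2
        simpa [hr] using h2.symm
      rw [← Finset.sum_filter_add_sum_filter_not _ (fun y => S y = true), hθ] at h1
      linarith [Real.sin_sq_add_cos_sq θ]
    set c : ℝ := -α * Real.sin θ ^ 2 + β * Real.cos θ ^ 2 with hc
    have hin : inner ℂ s.1 (phaseOracle S (groverState s S j).1) = (c : ℂ) := by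
      have h3 : ∀ y, inner ℂ (s.1 y) (phaseOracle S (groverState s S j).1 y) =
          (((if S y then -α * r y ^ 2 else β * r y ^ 2) : ℝ) : ℂ) := by
        intro y
        unfold phaseOracle
        rw [LinearIsometryEquiv.piLpCongrRight_apply]
        by_cases hy : S y <;> simp [hy, h, hr] <;> ring
      rw [PiLp.inner_apply, Finset.sum_congr rfl fun y _ => h3 y, ← Complex.ofReal_sum,
        Finset.sum_ite, ← Finset.mul_sum, ← Finset.mul_sum, hθ, hθ']
    have hstep : (groverState s S (j + 1)).1 = groverIteration s S (groverState s S j).1 := by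
      simp only [groverState, pow_succ']
      rfl
    have hc' : c = Real.cos ((2 * j + 2) * θ) := by
      have h4 : (2 * (j : ℝ) + 2) * θ = (2 * j + 1) * θ + θ := by ring
      rw [h4, Real.cos_add, ← hα, ← hβ, hc]
      ring
    have h5 : (2 * (j : ℝ) + 1) * θ = (2 * j + 2) * θ - θ := by ring
    have h6 : (2 * ((j + 1 : ℕ) : ℝ) + 1) * θ = (2 * j + 2) * θ + θ := by push_cast; ring
    refine ⟨2 * c + α, 2 * c - β, ?_, ?_, fun y => ?_⟩
    · rw [add_mul, hα, h5, h6, Real.sin_add, Real.sin_sub, hc']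
      ring
    · rw [sub_mul, hβ, h5, h6, Real.cos_add, Real.cos_sub, hc']
      ring
    · rw [hstep, groverIteration_apply, hin, hr, h]
      by_cases hy : S y <;> simp [hy] <;> ring

theorem measureBasis_apply_of_real {ψ : PureState Y} {y : Y} {a : ℝ} (h : ψ.1 y = (a : ℂ)) :
    measureBasis ψ y = ENNReal.ofReal (a ^ 2) := by
  change ENNReal.ofReal (‖ψ.1 y‖ ^ 2) = _
  rw [h, Complex.norm_real, Real.norm_eq_abs, sq_abs]

end Grover

/-! ### Measuring a Grover state and checking the outcome -/

section Search

variable {X : Type} [Fintype X] {P : X → Timed Bool}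

theorem sum_solution_eq_card_mul_solutionMean (g : Option (Solution P) → ℝ≥0∞) :
    ∑ x : Solution P, g (some x) = Fintype.card (Solution P) * solutionMean P g := by
  unfold solutionMean
  rcases isEmpty_or_nonempty (Solution P) with h | h
  · simp
  · rw [ENNReal.mul_div_cancel card_solution_ne_zero_of (by simp)]

/-- Checking a random outcome which is uniformly distributed on the solutions. -/
theorem searchBound_draw_check {Y : Type} {D : PMF Y} {f : Y → X} {u : ℝ≥0∞} {n c : ℕ} {p : ℝ}
    (hu : ∀ x, (P x).val = true → D.map f x = u) (hc : ∀ x, (P x).time ≤ c)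
    (hp : 1 ≤ Fintype.card (Solution P) * u + ENNReal.ofReal p) :
    SearchBound P (Comp.draw D n >>= fun y => check P (f y)) (n + (c + 1)) p := by
  intro w g e he
  rw [Comp.cost_bind, Comp.cost_draw]
  set F : X → ℝ≥0∞ := fun x => g (if h : (P x).val = true then some ⟨x, h⟩ else none) with hF
  have h1 : D.expect (fun y => (check P (f y)).cost w g) ≤
      w * (c + 1) + (D.map f).expect F := by
    rw [PMF.expect_map, ← PMF.expect_const_add]
    refine D.expect_mono fun y => ?_
    rw [check, Comp.cost_run]
    simp only [hF]
    gcongr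
    push_cast
    gcongr
    exact hc _
  set r : ℝ≥0∞ := ∑ x : {x // ¬ (P x).val = true}, D.map f x with hr
  have hsum : Fintype.card (Solution P) * u + r = 1 := by
    have h2 := (D.map f).tsum_coe
    rw [tsum_fintype, ← Fintype.sum_subtype_add_sum_subtype (fun x => (P x).val = true)] at h2
    rw [← h2, hr]
    congr 1
    rw [Finset.sum_congr rfl fun (x : Solution P) _ => hu x.1 x.2]
    simp
  have hrp : r ≤ ENNReal.ofReal p := by
    have h3 : Fintype.card (Solution P) * u ≠ ⊤ := fun h => by simp [h] at hsum
    refine (ENNReal.add_le_add_iff_left h3).1 ?_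
    rw [hsum]
    exact hp
  have h4 : (D.map f).expect F = Fintype.card (Solution P) * u * solutionMean P g + r * g none := by
    rw [PMF.expect_fintype, ← Fintype.sum_subtype_add_sum_subtype (fun x => (P x).val = true)]
    congr 1
    · rw [Finset.sum_congr rfl fun (x : Solution P) _ => show _ = u * g (some x) by
        rw [hu x.1 x.2]; simp [hF, x.2]]
      rw [← Finset.mul_sum, sum_solution_eq_card_mul_solutionMean]
      ring
    · rw [hr, Finset.sum_mul]
      refine Finset.sum_congr rfl fun x _ => ?_
      simp [hF, x.2]
  have h5 : (D.map f).expect F ≤ solutionMean P g + ENNReal.ofReal p * e :=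
    calc (D.map f).expect F
        ≤ Fintype.card (Solution P) * u * solutionMean P g + r * (solutionMean P g + e) := by
          rw [h4]; gcongr
      _ = (Fintype.card (Solution P) * u + r) * solutionMean P g + r * e := by ring
      _ ≤ _ := by rw [hsum, one_mul]; gcongr
  have h6 : ENNReal.ofReal ((n : ℝ) + (c + 1)) = n + (c + 1) := by
    rw [ENNReal.ofReal_add (by positivity) (by positivity),
      ENNReal.ofReal_add (by positivity) (by positivity)]
    simp
  calc _ ≤ w * n + (w * (c + 1) + (solutionMean P g + ENNReal.ofReal p * e)) := by
        gcongr
        exact h1.trans (by gcongr)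
    _ = _ := by rw [h6]; ring

theorem queryTime_le {Y : Type} [Fintype Y] {P : Y → Timed Bool} {c : ℕ}
    (hc : ∀ y, (P y).time ≤ c) : queryTime P ≤ 2 * c + 1 := by
  unfold queryTime
  have := Finset.sup_le (s := Finset.univ) fun y _ => hc y
  omega

theorem card_solution_le : Fintype.card (Solution P) ≤ Fintype.card X :=
  Fintype.card_subtype_le _

variable [Nonempty X]

/-- The rotation angle `θ` of Grover's algorithm, `sin θ = √(t / |X|)`. -/
def groverAngle (X : Type) [Fintype X] (t : ℕ) : ℝ := Real.arcsin √((t : ℝ) / Fintype.card X)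

theorem sin_groverAngle {t : ℕ} (ht : t ≤ Fintype.card X) :
    Real.sin (groverAngle X t) = √((t : ℝ) / Fintype.card X) := by
  have hN : (0 : ℝ) < Fintype.card X := by exact_mod_cast Fintype.card_pos
  refine Real.sin_arcsin ((by norm_num : (-1 : ℝ) ≤ 0).trans (Real.sqrt_nonneg _)) ?_
  rw [Real.sqrt_le_one, div_le_one hN]
  exact_mod_cast ht

theorem sin_sq_groverAngle {t : ℕ} (ht : t ≤ Fintype.card X) :
    Real.sin (groverAngle X t) ^ 2 = (t : ℝ) / Fintype.card X := by
  rw [sin_groverAngle ht, Real.sq_sqrt (by positivity)]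

/-- Grover's algorithm with `j` iterations, followed by a check of the outcome. -/
theorem searchBound_amplify_uniform {c : ℕ} (hc : ∀ x, (P x).time ≤ c) (j : ℕ) {p : ℝ}
    (hp : 1 ≤ p ∨ 0 < Fintype.card (Solution P) ∧ 0 ≤ p ∧
      1 - Real.sin ((2 * j + 1) * groverAngle X (Fintype.card (Solution P))) ^ 2 ≤ p) :
    SearchBound P (amplify (uniformState X) P j >>= fun x => check P x)
      (j * (2 * c + 4) + (c + 3)) p := by
  have hN : (0 : ℝ) < Fintype.card X := by exact_mod_cast Fintype.card_pos
  set t := Fintype.card (Solution P) with ht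
  set θ := groverAngle X t
  have hs : Real.sin θ ^ 2 = (t : ℝ) / Fintype.card X := sin_sq_groverAngle card_solution_le
  obtain ⟨α, β, hα, -, h⟩ := groverState_apply (s := uniformState X)
    (S := fun x => (P x).val) (r := fun _ => 1 / √(Fintype.card X : ℝ)) (θ := θ) (fun _ => rfl)
    (by
      rw [hs, Finset.sum_const, ← Fintype.card_subtype, nsmul_eq_mul, div_pow,
        Real.sq_sqrt hN.le, ← ht]
      ring) j
  have hu : ∀ x, (P x).val = true →
      (measureBasis (groverState (uniformState X) (fun x => (P x).val) j)).map id x =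
        ENNReal.ofReal (α ^ 2 / Fintype.card X) := by
    intro x hx
    rw [PMF.map_id, measureBasis_apply_of_real (h x)]
    simp [hx, mul_pow, Real.sq_sqrt hN.le, div_eq_mul_inv]
  refine (searchBound_draw_check hu hc (n := 1 + j * (queryTime P + 3) + 1) ?_).mono ?_ le_rfl
  · rcases hp with hp | ⟨h0, h1, h2⟩
    · exact le_add_left (by simpa using hp)
    · rw [← ht, ← ENNReal.ofReal_natCast, ← ENNReal.ofReal_mul (by positivity),
        ← ENNReal.ofReal_add (by positivity) h1, ENNReal.one_le_ofReal]
      have h3 : (t : ℝ) * (α ^ 2 / Fintype.card X) = Real.sin ((2 * j + 1) * θ) ^ 2 := by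
        rw [← hα, mul_pow, hs]
        ring
      rw [h3]
      linarith
  · have h1 : (queryTime P : ℝ) ≤ 2 * c + 1 := by exact_mod_cast queryTime_le hc
    push_cast
    nlinarith [mul_le_mul_of_nonneg_left h1 (Nat.cast_nonneg j : (0 : ℝ) ≤ j)]

end Search

/-! ### Grover's algorithm with a random number of iterations -/

/-- With `x = (2 j + 1) θ`, the product `2 cos (2 x) sin (2 θ)` is `sin (2 x + 2 θ) - sin (2 x - 2
θ)`, so the sum telescopes. -/
theorem sum_sin_sq_odd_mul (θ : ℝ) (M : ℕ) :
    4 * Real.sin (2 * θ) * ∑ j ∈ Finset.range M, Real.sin ((2 * j + 1) * θ) ^ 2 =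
      2 * M * Real.sin (2 * θ) - Real.sin (4 * M * θ) := by
  induction M with
  | zero => simp
  | succ M ih =>
    rw [Finset.sum_range_succ, mul_add, ih]
    have h1 : (4 : ℝ) * M * θ = 2 * ((2 * M + 1) * θ) - 2 * θ := by ring
    have h2 : (4 : ℝ) * (M + 1 : ℕ) * θ = 2 * ((2 * M + 1) * θ) + 2 * θ := by push_cast; ring
    rw [h1, h2, Real.sin_add, Real.sin_sub, Real.sin_sq_eq_half_sub]
    push_cast
    ring

/-- A random number of iterations below `M ≥ 1 / sin θ` succeeds with probability at least
`1 / 4`. -/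
theorem quarter_le_sum_sin_sq {θ : ℝ} (h0 : 0 ≤ θ) (h1 : θ ≤ Real.pi / 2) {M : ℕ}
    (hM : 1 ≤ M * Real.sin θ) :
    (M : ℝ) / 4 ≤ ∑ j ∈ Finset.range M, Real.sin ((2 * j + 1) * θ) ^ 2 := by
  have key := sum_sin_sq_odd_mul θ M
  set total := ∑ j ∈ Finset.range M, Real.sin ((2 * j + 1) * θ) ^ 2 with htotal
  have hM0 : (0 : ℝ) < M := by
    rcases Nat.eq_zero_or_pos M with h | h
    · simp [h] at hM; linarith
    · exact_mod_cast h
  -- For `θ ≤ π / 4` the bound on `sin (4 M θ)` follows from `M sin (2 θ) = 2 M sin θ cos θ ≥ 1`.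
  -- Larger angles are reflected to `x = π - 2 θ`.
  have finish : 0 < Real.sin (2 * θ) → Real.sin (4 * M * θ) ≤ M * Real.sin (2 * θ) →
      (M : ℝ) / 4 ≤ total := by
    intro hs h
    have : M * Real.sin (2 * θ) ≤ 4 * Real.sin (2 * θ) * total := by rw [key]; linarith
    have h2 : 0 ≤ Real.sin (2 * θ) * (4 * total - M) := by linarith
    have := nonneg_of_mul_nonneg_right h2 hs
    linarith
  rcases le_total θ (Real.pi / 4) with hθ | hθ
  · have hc : 1 / 2 ≤ Real.cos θ := by
      rw [← Real.cos_pi_div_three]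
      exact Real.cos_le_cos_of_nonneg_of_le_pi h0 (by linarith [Real.pi_pos])
        (by linarith [Real.pi_pos])
    have h3 : 1 ≤ M * Real.sin (2 * θ) := by
      rw [Real.sin_two_mul]
      nlinarith
    refine finish ?_ ((Real.sin_le_one _).trans h3)
    by_contra hn
    nlinarith
  · set x := Real.pi - 2 * θ with hx
    have hx0 : 0 ≤ x := by linarith
    have hx1 : x ≤ Real.pi / 2 := by linarith
    have e1 : Real.sin (2 * θ) = Real.sin x := by rw [hx, Real.sin_pi_sub]
    have e2 : Real.sin (4 * M * θ) = -Real.sin (2 * M * x) := by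
      have : 4 * M * θ = M * (2 * Real.pi) - 2 * M * x := by rw [hx]; ring
      rw [this, Real.sin_nat_mul_two_pi_sub]
    -- At `x = 0` every state is a solution and each term of the sum is `1`. Otherwise either `2 M x
    -- ≤ π`, where `-sin (2 M x) ≤ 0`, or Jordan's inequality `sin x ≥ 2 x / π` gives `M sin x ≥ 1`.
    rcases hx0.eq_or_lt with h | h
    · have hθ' : θ = Real.pi / 2 := by linarith
      have : total = M := by
        rw [htotal, Finset.sum_congr rfl (g := fun _ => (1 : ℝ)), Finset.sum_const]
        · simp
        · intro j _
          have h5 : 2 * ((2 * (j : ℝ) + 1) * θ) = (2 * j + 1 : ℕ) * Real.pi := by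
            rw [hθ']; push_cast; ring
          rw [Real.sin_sq_eq_half_sub, h5, Real.cos_nat_mul_pi, pow_succ, pow_mul]
          norm_num
      linarith
    · have hjordan := Real.mul_le_sin hx0 hx1
      have hs : 0 < Real.sin x := Real.sin_pos_of_pos_of_lt_pi h (by linarith)
      refine finish (e1 ▸ hs) ?_
      rw [e1, e2]
      rcases le_total (2 * M * x) Real.pi with h6 | h6
      · have := Real.sin_nonneg_of_nonneg_of_le_pi (by positivity : 0 ≤ 2 * (M : ℝ) * x) h6
        nlinarith
      · have h7 : 1 ≤ M * Real.sin x := by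
          have : (M : ℝ) * (2 / Real.pi * x) ≤ M * Real.sin x := by gcongr
          refine le_trans ?_ this
          rw [show (M : ℝ) * (2 / Real.pi * x) = 2 * M * x / Real.pi by ring,
            le_div_iff₀ Real.pi_pos]
          linarith
        linarith [Real.neg_one_le_sin (2 * M * x)]

section Search

variable {X : Type} [Fintype X] [Nonempty X] {P : X → Timed Bool}

theorem searchBound_randomGrover_of {c : ℕ} {m p : ℝ} (hm : 1 ≤ m)
    (q : ℕ → ℝ) (hq : ∀ j, SearchBound P (amplify (uniformState X) P j >>= fun x => check P x)
      (j * (2 * c + 4) + (c + 3)) (q j)) (hq0 : ∀ j, 0 ≤ q j)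
    (hp : ∑ j ∈ Finset.range ⌈m⌉₊, q j ≤ ⌈m⌉₊ * p) :
    SearchBound P (randomGrover P m) ((3 * c + 8) * m) p := by
  have hm1 : 1 ≤ ⌈m⌉₊ := Nat.one_le_ceil_iff.2 (by linarith)
  have hlt : (⌈m⌉₊ : ℝ) < m + 1 := Nat.ceil_lt_add_one (by linarith)
  unfold randomGrover randBelow
  refine (SearchBound.draw_map_bind (T := m * (2 * c + 4) + (c + 3)) _ _ _
    (q := fun a => q a.1) (p := p) (fun a => ?_) (by positivity) ?_).mono ?_ le_rfl
  · refine (hq a.1).mono ?_ le_rfl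
    have h1 : (a.1 : ℝ) + 1 ≤ ⌈m⌉₊ := by exact_mod_cast (by omega : a.1 + 1 ≤ ⌈m⌉₊)
    have h2 : (a.1 : ℝ) ≤ m := by linarith
    gcongr
  · simp only [PMF.uniformOfFintype_apply, Fintype.card_fin]
    rw [← Finset.mul_sum, ← ENNReal.ofReal_sum_of_nonneg fun a _ => hq0 _,
      Fin.sum_univ_eq_sum_range fun j => q j, Nat.sub_add_cancel hm1]
    have h0 : (0 : ℝ) < ⌈m⌉₊ := by exact_mod_cast hm1
    rw [← ENNReal.ofReal_natCast, ← ENNReal.ofReal_inv_of_pos h0,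
      ← ENNReal.ofReal_mul (by positivity)]
    refine ENNReal.ofReal_le_ofReal ?_
    rw [inv_mul_le_iff₀ h0]
    exact hp
  · push_cast
    nlinarith [(Nat.cast_nonneg c : (0 : ℝ) ≤ c)]

theorem searchBound_randomGrover {c : ℕ} (hc : ∀ x, (P x).time ≤ c) {m : ℝ} (hm : 1 ≤ m) :
    SearchBound P (randomGrover P m) ((3 * c + 8) * m) 1 :=
  searchBound_randomGrover_of hm (fun _ => 1)
    (fun j => searchBound_amplify_uniform hc j (Or.inl le_rfl)) (by simp) (by simp)

theorem searchBound_randomGrover_of_sqrt_le {c : ℕ} (hc : ∀ x, (P x).time ≤ c) {m : ℝ}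
    (hm : 1 ≤ m) (ht : 0 < Fintype.card (Solution P))
    (h : √((Fintype.card X : ℝ) / Fintype.card (Solution P)) ≤ m) :
    SearchBound P (randomGrover P m) ((3 * c + 8) * m) (3 / 4) := by
  set θ := groverAngle X (Fintype.card (Solution P)) with hθ
  have hN : (0 : ℝ) < Fintype.card X := by exact_mod_cast Fintype.card_pos
  have ht' : (0 : ℝ) < Fintype.card (Solution P) := by exact_mod_cast ht
  refine searchBound_randomGrover_of hm
    (fun j => 1 - Real.sin ((2 * j + 1) * θ) ^ 2)
    (fun j => searchBound_amplify_uniform hc j (Or.inr ⟨ht, ?_, le_rfl⟩)) (fun j => ?_) ?_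
  · linarith [Real.sin_sq_le_one ((2 * j + 1) * θ)]
  · linarith [Real.sin_sq_le_one ((2 * j + 1) * θ)]
  · rw [Finset.sum_sub_distrib]
    have h1 : 1 ≤ (⌈m⌉₊ : ℝ) * Real.sin θ := by
      rw [sin_groverAngle card_solution_le]
      have h2 : √((Fintype.card X : ℝ) / Fintype.card (Solution P)) ≤ ⌈m⌉₊ :=
        h.trans (Nat.le_ceil m)
      calc (1 : ℝ) = √((Fintype.card X : ℝ) / Fintype.card (Solution P)) *
            √((Fintype.card (Solution P) : ℝ) / Fintype.card X) := by
            rw [← Real.sqrt_mul (by positivity), div_mul_div_cancel₀ ht'.ne', div_self hN.ne',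
              Real.sqrt_one]
        _ ≤ _ := by gcongr
    have h3 := quarter_le_sum_sin_sq (θ := θ) (Real.arcsin_nonneg.2 (Real.sqrt_nonneg _))
      (Real.arcsin_le_pi_div_two _) h1
    simp only [Finset.sum_const, Finset.card_range, nsmul_eq_mul, mul_one]
    linarith

end Search

/-! ### BBHT -/

section Search

variable {X : Type} [Fintype X] [Nonempty X] {P : X → Timed Bool}

theorem SearchBound.bbhtLoop_succ {n : ℕ} {m T T' p p' : ℝ}
    (h : SearchBound P (randomGrover P m) T p) (h' : SearchBound P (bbhtLoop P n (8 / 7 * m)) T' p')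
    (hT : 0 ≤ T) (hp : 0 ≤ p) (hT' : 0 ≤ T') :
    SearchBound P (bbhtLoop P (n + 1) m) (T + 1 + p * (T' + 2)) (p * p') := by
  unfold bbhtLoop
  refine h.orElse ?_ hT hp (by positivity)
  have := (h'.run_op_bind (a := decide (8 / 7 * m ≤ 2 * √(Fintype.card X : ℝ)))
    (f := fun _ => bbhtLoop P n (8 / 7 * m)) hT').run_op_bind (a := 8 / 7 * m)
    (f := fun m' => Comp.run (op (decide (m' ≤ 2 * √(Fintype.card X : ℝ)))) >>= fun _ =>
      bbhtLoop P n m') (by positivity)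
  rw [show T' + 2 = T' + 1 + 1 by ring]
  exact this

/-- Rounds whose parameter is large enough to succeed with constant probability. -/
theorem searchBound_bbhtLoop_of_sqrt_le {c : ℕ} (hc : ∀ x, (P x).time ≤ c)
    (ht : 0 < Fintype.card (Solution P)) (n : ℕ) {m : ℝ} (hm : 1 ≤ m)
    (h : √((Fintype.card X : ℝ) / Fintype.card (Solution P)) ≤ m) :
    SearchBound P (bbhtLoop P n m) (7 * (3 * c + 11) * m) ((3 / 4) ^ n) := by
  induction n generalizing m with
  | zero =>
    rw [pow_zero]
    exact searchBound_pure_none.mono (by positivity) le_rfl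
  | succ n ih =>
    refine ((searchBound_randomGrover_of_sqrt_le hc hm ht h).bbhtLoop_succ
      (ih (m := 8 / 7 * m) (by linarith) (by linarith)) (by positivity) (by positivity)
      (by positivity)).mono ?_ (by rw [pow_succ'])
    -- The expected cost per round shrinks by the factor `3 / 4 * 8 / 7 = 6 / 7`, whose geometric
    -- series sums to `7`.
    nlinarith [(Nat.cast_nonneg c : (0 : ℝ) ≤ c)]

/-- The cost of `k` initial rounds, whatever their success. -/
theorem SearchBound.bbhtLoop_add {c : ℕ} (hc : ∀ x, (P x).time ≤ c) (k : ℕ) {n : ℕ} {m T p : ℝ}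
    (hm : 1 ≤ m) (h : SearchBound P (bbhtLoop P n (m * (8 / 7) ^ k)) T p) (hT : 0 ≤ T) :
    SearchBound P (bbhtLoop P (n + k) m) (7 * (3 * c + 11) * m * ((8 / 7) ^ k - 1) + T) p := by
  induction k generalizing m with
  | zero => exact (by simpa using h : SearchBound P (bbhtLoop P n m) T p).mono (by simp) le_rfl
  | succ k ih =>
    have h1 : (1 : ℝ) ≤ (8 / 7) ^ k := one_le_pow₀ (by norm_num)
    have h2 : 0 ≤ (8 / 7 : ℝ) ^ k - 1 := by linarith
    have hm0 : 0 ≤ m := by linarith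
    have := (searchBound_randomGrover hc hm).bbhtLoop_succ
      (ih (m := 8 / 7 * m) (by linarith) (by rwa [mul_comm (8 / 7) m, mul_assoc, ← pow_succ']))
      (by positivity) zero_le_one (by positivity)
    refine this.mono ?_ (by simp)
    rw [pow_succ]
    nlinarith [(Nat.cast_nonneg c : (0 : ℝ) ≤ c)]

theorem pow_floor_logb_le {b x : ℝ} (hb : 1 < b) (hx : 1 ≤ x) : b ^ ⌊Real.logb b x⌋₊ ≤ x := by
  rw [← Real.rpow_natCast, ← Real.le_logb_iff_rpow_le hb (by linarith)]
  exact Nat.floor_le (Real.logb_nonneg hb hx)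

theorem le_pow_of_logb_le {b x : ℝ} (hb : 1 < b) (hx : 0 < x) {n : ℕ} (h : Real.logb b x ≤ n) :
    x ≤ b ^ n := by
  rwa [← Real.rpow_natCast, ← Real.logb_le_iff_le_rpow hb hx]

theorem pow_ceil_logb_le {b x : ℝ} (hb : 1 < b) (hx : 1 ≤ x) :
    b ^ ⌈Real.logb b x⌉₊ ≤ b * x := by
  have h := (Nat.ceil_lt_add_one (Real.logb_nonneg hb hx)).le
  rw [← Real.rpow_natCast, ← Real.le_logb_iff_rpow_le hb (by positivity),
    Real.logb_mul (by positivity) (by positivity), Real.logb_self_eq_one hb]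
  linarith

theorem one_le_two_mul_sqrt_card : 1 ≤ 2 * √(Fintype.card X : ℝ) := by
  have : 1 ≤ √(Fintype.card X : ℝ) := by
    rw [Real.one_le_sqrt]
    exact_mod_cast Fintype.card_pos
  linarith

theorem searchBound_bbht {c : ℕ} (hc : ∀ x, (P x).time ≤ c) :
    SearchBound P (bbht P) (16 * (3 * c + 11) * √(Fintype.card X : ℝ)) 1 := by
  unfold bbht
  have h := SearchBound.bbhtLoop_add hc
    (⌊Real.logb (8 / 7) (2 * √(Fintype.card X : ℝ))⌋₊ + 1) (n := 0) (m := 1) (P := P) le_rfl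
    (searchBound_pure_none) le_rfl
  rw [zero_add] at h
  refine h.mono ?_ le_rfl
  have h1 := pow_floor_logb_le (b := 8 / 7) (by norm_num) (one_le_two_mul_sqrt_card (X := X))
  rw [pow_succ]
  nlinarith [(Nat.cast_nonneg c : (0 : ℝ) ≤ c)]

/-- After `k` rounds the parameter has reached `μ = √(N / t)`, and each of the remaining `R - k`
rounds fails with probability at most `3 / 4 ≤ (7 / 8) ^ 2`. Over these rounds the parameter grows
by a factor `z` of order at least `√t`, so the failure probability is at most `1 / z ^ 2 = O(1 /
t)`. -/
theorem searchBound_bbht_of_pos {c : ℕ} (hc : ∀ x, (P x).time ≤ c)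
    (ht : 0 < Fintype.card (Solution P)) :
    SearchBound P (bbht P)
      (16 * (3 * c + 11) * √((Fintype.card X : ℝ) / Fintype.card (Solution P)))
      (1 / (2 * Fintype.card (Solution P))) := by
  have hlam : (1 : ℝ) < 8 / 7 := by norm_num
  have ht' : (0 : ℝ) < Fintype.card (Solution P) := by exact_mod_cast ht
  have ht1 : (1 : ℝ) ≤ Fintype.card (Solution P) := by exact_mod_cast ht
  have htN : (Fintype.card (Solution P) : ℝ) ≤ Fintype.card X := by exact_mod_cast card_solution_le
  set N := (Fintype.card X : ℝ)
  set t := (Fintype.card (Solution P) : ℝ)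
  set μ := √(N / t) with hμ
  have hμ1 : 1 ≤ μ := by rw [hμ, Real.one_le_sqrt, one_le_div ht']; exact htN
  have hL1 : 1 ≤ 2 * √N := one_le_two_mul_sqrt_card
  have hμN : μ ≤ 2 * √N := by
    have : μ ≤ √N := Real.sqrt_le_sqrt (div_le_self (by linarith) ht1)
    linarith [Real.sqrt_nonneg N]
  set R := ⌊Real.logb (8 / 7) (2 * √N)⌋₊ + 1 with hR
  set k := ⌈Real.logb (8 / 7) μ⌉₊ with hk
  have hLR : Real.logb (8 / 7) (2 * √N) ≤ R := by
    rw [hR]; push_cast; exact (Nat.lt_floor_add_one _).le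
  have hkR : k ≤ R := Nat.ceil_le.2
    ((Real.logb_le_logb_of_le hlam (by linarith) hμN).trans hLR)
  have hk1 : μ ≤ (8 / 7) ^ k := le_pow_of_logb_le hlam (by linarith) (Nat.le_ceil _)
  have hk2 : (8 / 7) ^ k ≤ 8 / 7 * μ := pow_ceil_logb_le hlam hμ1
  have hR1 : 2 * √N ≤ (8 / 7) ^ R := le_pow_of_logb_le hlam (by linarith) hLR
  have hloop := SearchBound.bbhtLoop_add hc k (n := R - k) (m := 1) le_rfl
    (searchBound_bbhtLoop_of_sqrt_le hc ht (R - k) (m := 1 * (8 / 7) ^ k)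
      (by linarith) (by rw [one_mul]; exact hk1)) (by positivity)
  rw [Nat.sub_add_cancel hkR] at hloop
  refine hloop.mono ?_ ?_
  · nlinarith [(Nat.cast_nonneg c : (0 : ℝ) ≤ c)]
  · have h1 : (3 / 4 : ℝ) ^ (R - k) ≤ ((7 / 8) ^ 2) ^ (R - k) := by
      gcongr; norm_num
    set z : ℝ := (8 / 7) ^ (R - k) with hz
    have hz0 : 0 < z := by positivity
    have h2 : z * (8 / 7) ^ k = (8 / 7) ^ R := by rw [hz, ← pow_add, Nat.sub_add_cancel hkR]
    have h3 : 2 * √N ≤ z * (8 / 7 * μ) := by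
      rw [← h2] at hR1
      exact hR1.trans (by gcongr)
    have h4 : √N = √t * μ := by
      rw [hμ, ← Real.sqrt_mul ht'.le, mul_div_cancel₀ _ ht'.ne']
    -- So `1 / z ^ 2 ≤ 16 / (49 t)`, which is below `1 / (2 t)`.
    have h5 : 2 * √t ≤ z * (8 / 7) := by
      rw [h4] at h3
      have : (2 * √t) * μ ≤ (z * (8 / 7)) * μ := by linarith
      exact le_of_mul_le_mul_right this (by linarith)
    have h6 : (2 * √t) ^ 2 ≤ (z * (8 / 7)) ^ 2 := by gcongr
    rw [mul_pow, Real.sq_sqrt ht'.le] at h6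
    have h7 : (((7 : ℝ) / 8) ^ 2) ^ (R - k) = 1 / z ^ 2 := by
      rw [hz, ← pow_mul, ← pow_mul, mul_comm 2, pow_mul, pow_mul, ← one_div_pow, ← one_div_pow]
      norm_num
    rw [h7] at h1
    refine h1.trans ?_
    gcongr
    nlinarith

end Search

/-! ### Exact search, BCWZ and findsol -/

section Search

variable {X : Type} [Fintype X] [Nonempty X] {P : X → Timed Bool}

theorem groverAngle_pos {t : ℕ} (ht : 0 < t) : 0 < groverAngle X t := by
  have : (0 : ℝ) < Fintype.card X := by exact_mod_cast Fintype.card_pos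
  have : (0 : ℝ) < t := by exact_mod_cast ht
  exact Real.arcsin_pos.2 (by positivity)

omit [Nonempty X] in
theorem exactIterations_eq (t : ℕ) :
    exactIterations X t = ⌈(Real.pi / (2 * groverAngle X t) - 1) / 2⌉₊ := rfl

/-- From `θ ≥ sin θ = 1 / μ` and `π ≤ 4`, the ceiling is at most `μ + 1 / 2`, where `μ = √(|X| / t)
≥ 1`. -/
theorem exactIterations_le {t : ℕ} (ht : 0 < t) (htX : t ≤ Fintype.card X) :
    (exactIterations X t : ℝ) ≤ 2 * √((Fintype.card X : ℝ) / t) := by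
  have hN : (0 : ℝ) < Fintype.card X := by exact_mod_cast Fintype.card_pos
  have ht' : (0 : ℝ) < t := by exact_mod_cast ht
  have hθ := groverAngle_pos (X := X) ht
  have hsin : √((t : ℝ) / Fintype.card X) ≤ groverAngle X t := by
    rw [← sin_groverAngle htX]
    exact Real.sin_le hθ.le
  have hinv : √((Fintype.card X : ℝ) / t) * √((t : ℝ) / Fintype.card X) = 1 := by
    rw [← Real.sqrt_mul (by positivity), div_mul_div_cancel₀ ht'.ne', div_self hN.ne',
      Real.sqrt_one]
  set μ := √((Fintype.card X : ℝ) / t) with hμ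
  have hμ1 : 1 ≤ μ := by
    rw [hμ, Real.one_le_sqrt, one_le_div ht']
    exact_mod_cast htX
  have h1 : 1 ≤ μ * groverAngle X t := by
    rw [← hinv]
    gcongr
  have h2 : Real.pi / (2 * groverAngle X t) ≤ 2 * μ := by
    rw [div_le_iff₀ (by positivity)]
    nlinarith [Real.pi_le_four]
  have hpos : 0 ≤ (Real.pi / (2 * groverAngle X t) - 1) / 2 := by
    have : 1 ≤ Real.pi / (2 * groverAngle X t) := by
      rw [one_le_div (by positivity)]
      have : groverAngle X t ≤ Real.pi / 2 := Real.arcsin_le_pi_div_two _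
      linarith
    linarith
  have h3 := Nat.ceil_lt_add_one hpos
  rw [← exactIterations_eq] at h3
  linarith

/-- The auxiliary qubit adjusts the rotation angle to a fraction of a right angle. -/
theorem sin_groverAngle_mul_sin_exactAngle {t : ℕ} (ht : 0 < t) (htX : t ≤ Fintype.card X) :
    Real.sin (groverAngle X t) * Real.sin (exactAngle X t) =
      Real.sin (Real.pi / (4 * exactIterations X t + 2)) := by
  have hN : (0 : ℝ) < Fintype.card X := by exact_mod_cast Fintype.card_pos
  have ht' : (0 : ℝ) < t := by exact_mod_cast ht
  have hθ := groverAngle_pos (X := X) ht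
  have hp : 0 < √((t : ℝ) / Fintype.card X) := by positivity
  have hle : Real.pi / (4 * exactIterations X t + 2) ≤ groverAngle X t := by
    have := Nat.le_ceil ((Real.pi / (2 * groverAngle X t) - 1) / 2)
    rw [← exactIterations_eq] at this
    have h2 : Real.pi / (2 * groverAngle X t) ≤ 2 * exactIterations X t + 1 := by linarith
    rw [div_le_iff₀ (by positivity)] at h2
    rw [div_le_iff₀ (by positivity)]
    linarith
  have hk0 : 0 ≤ Real.pi / (4 * (exactIterations X t : ℝ) + 2) := by positivity
  have hle2 : groverAngle X t ≤ Real.pi / 2 := Real.arcsin_le_pi_div_two _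
  have hs : Real.sin (Real.pi / (4 * exactIterations X t + 2)) ≤ √((t : ℝ) / Fintype.card X) := by
    rw [← sin_groverAngle htX]
    exact Real.sin_le_sin_of_le_of_le_pi_div_two (by linarith [Real.pi_pos]) hle2 hle
  have hs0 : 0 ≤ Real.sin (Real.pi / (4 * exactIterations X t + 2)) :=
    Real.sin_nonneg_of_nonneg_of_le_pi hk0 (by linarith [Real.pi_pos])
  have h0 : 0 ≤ Real.sin (Real.pi / (4 * exactIterations X t + 2)) /
      √((t : ℝ) / Fintype.card X) := by positivity
  rw [sin_groverAngle htX, exactAngle, Real.sin_arcsin (by linarith) (by rwa [div_le_one hp]),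
    mul_div_cancel₀ _ hp.ne']

/-- The predicate of the exact search: a solution, and the auxiliary qubit is set. -/
def tiltedPredicate (P : X → Timed Bool) (z : X × Bool) : Timed Bool := do
  let b ← P z.1
  op (b && z.2)

theorem searchBound_amplify_tilted {c : ℕ} (hc : ∀ x, (P x).time ≤ c) (a φ : ℝ) (k : ℕ) {p : ℝ}
    (hφ : (Fintype.card (Solution P) : ℝ) / Fintype.card X * Real.sin a ^ 2 = Real.sin φ ^ 2)
    (hp : 1 ≤ p ∨ Real.sin φ ≠ 0 ∧ 0 ≤ p ∧ 1 - Real.sin ((2 * k + 1) * φ) ^ 2 ≤ p) :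
    SearchBound P (amplify (tiltedState X a) (tiltedPredicate P) k >>= fun z => check P z.1)
      (k * (2 * c + 6) + (c + 3)) p := by
  have hN : (0 : ℝ) < Fintype.card X := by exact_mod_cast Fintype.card_pos
  set r : X × Bool → ℝ := fun z =>
    1 / √(Fintype.card X : ℝ) * (if z.2 then Real.sin a else Real.cos a) with hr
  set S : X × Bool → Bool := fun z => (tiltedPredicate P z).val with hS
  have hSval : ∀ x b, S (x, b) = ((P x).val && b) := fun x b => rfl
  have hsum : ∑ z with S z = true, r z ^ 2 = Real.sin φ ^ 2 := by
    rw [Finset.sum_filter, Fintype.sum_prod_type]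
    simp only [Fintype.sum_bool, hSval, hr, Bool.and_true, Bool.and_false, if_true,
      Bool.false_eq_true, if_false, add_zero]
    rw [← Finset.sum_filter, Finset.sum_const, ← Fintype.card_subtype, nsmul_eq_mul, mul_pow,
      div_pow, Real.sq_sqrt hN.le, ← hφ]
    ring
  obtain ⟨α, β, hα, -, h⟩ := groverState_apply (s := tiltedState X a) (S := S) (r := r) (θ := φ)
    (fun _ => rfl) hsum k
  set u : ℝ := (α ^ 2 * Real.sin a ^ 2 + β ^ 2 * Real.cos a ^ 2) / Fintype.card X with hudef
  have hu : ∀ x, (P x).val = true →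
      (measureBasis (groverState (tiltedState X a) S k)).map Prod.fst x = ENNReal.ofReal u := by
    intro x hx
    rw [PMF.map_apply, tsum_fintype, Fintype.sum_prod_type, Finset.sum_eq_single x]
    · simp only [if_true, Fintype.sum_bool]
      rw [measureBasis_apply_of_real (h _), measureBasis_apply_of_real (h _),
        ← ENNReal.ofReal_add (by positivity) (by positivity)]
      congr 1
      simp only [hSval, hx, hr, Bool.and_true, Bool.and_false, if_true, Bool.false_eq_true,
        if_false, mul_pow, div_pow, Real.sq_sqrt hN.le, hudef]
      ring
    · intro y _ hy
      simp [hy.symm]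
    · simp
  refine (searchBound_draw_check hu hc (n := 1 + k * (queryTime (tiltedPredicate P) + 3) + 1)
    (p := p) ?_).mono ?_ le_rfl
  · rcases hp with hp | ⟨h0, h1, h2⟩
    · exact le_add_left (by simpa using hp)
    · rw [← ENNReal.ofReal_natCast, ← ENNReal.ofReal_mul (by positivity),
        ← ENNReal.ofReal_add (by positivity) h1, ENNReal.one_le_ofReal]
      -- Only an inequality: the check ignores the auxiliary qubit, so a solution measured with that
      -- qubit unset also counts as success.
      have h3 : Real.sin ((2 * k + 1) * φ) ^ 2 ≤ (Fintype.card (Solution P) : ℝ) * u := by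
        rw [← hα, mul_pow, ← hφ, hudef]
        have : 0 ≤ (Fintype.card (Solution P) : ℝ) / Fintype.card X * (β ^ 2 * Real.cos a ^ 2) := by
          positivity
        calc _ ≤ α ^ 2 * (Fintype.card (Solution P) / Fintype.card X * Real.sin a ^ 2) +
              (Fintype.card (Solution P) : ℝ) / Fintype.card X * (β ^ 2 * Real.cos a ^ 2) := by
              linarith
          _ = _ := by ring
      linarith
  · have hq : ∀ z, (tiltedPredicate P z).time ≤ c + 1 := fun z => by
      change (P z.1).time + 1 ≤ c + 1
      exact Nat.add_le_add_right (hc _) 1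
    have h1 : (queryTime (tiltedPredicate P) : ℝ) ≤ 2 * (c + 1) + 1 := by
      exact_mod_cast queryTime_le hq
    push_cast
    nlinarith [mul_le_mul_of_nonneg_left h1 (Nat.cast_nonneg k : (0 : ℝ) ≤ k)]

theorem exactSearch_eq (P : X → Timed Bool) (t : ℕ) :
    exactSearch P t = Comp.run (op (exactIterations X t)) >>= fun k =>
      Comp.run (op (exactAngle X t)) >>= fun a =>
        amplify (tiltedState X a) (tiltedPredicate P) k >>= fun z => check P z.1 := rfl

theorem searchBound_exactSearch {c : ℕ} (hc : ∀ x, (P x).time ≤ c) {t : ℕ} (ht : 0 < t)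
    (htX : t ≤ Fintype.card X) :
    SearchBound P (exactSearch P t) ((5 * c + 17) * √((Fintype.card X : ℝ) / t))
      (if t = Fintype.card (Solution P) then 0 else 1) := by
  have hN : (0 : ℝ) < Fintype.card X := by exact_mod_cast Fintype.card_pos
  have ht' : (0 : ℝ) < t := by exact_mod_cast ht
  have hμ1 : 1 ≤ √((Fintype.card X : ℝ) / t) := by
    rw [Real.one_le_sqrt, one_le_div ht']
    exact_mod_cast htX
  rw [exactSearch_eq]
  have key : SearchBound P (amplify (tiltedState X (exactAngle X t)) (tiltedPredicate P)
      (exactIterations X t) >>= fun z => check P z.1)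
      (exactIterations X t * (2 * c + 6) + (c + 3))
      (if t = Fintype.card (Solution P) then 0 else 1) := by
    split_ifs with h
    · refine searchBound_amplify_tilted hc _ (Real.pi / (4 * exactIterations X t + 2)) _ ?_
        (Or.inr ⟨?_, le_rfl, ?_⟩)
      · rw [← h, ← sin_groverAngle_mul_sin_exactAngle ht htX, mul_pow, sin_sq_groverAngle htX]
      · refine (Real.sin_pos_of_pos_of_lt_pi (by positivity [Real.pi_pos]) ?_).ne'
        rw [div_lt_iff₀ (by positivity)]
        nlinarith [Real.pi_pos, (Nat.cast_nonneg (exactIterations X t) :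
          (0 : ℝ) ≤ exactIterations X t)]
      · have : (2 * (exactIterations X t : ℝ) + 1) * (Real.pi / (4 * exactIterations X t + 2)) =
            Real.pi / 2 := by
          field_simp
          ring
        rw [this, Real.sin_pi_div_two]
        norm_num
    -- For a wrong guess of `t` only the running time and the uniformity of the output matter; the
    -- angle is whatever the actual amplitude gives.
    · set s := √((Fintype.card (Solution P) : ℝ) / Fintype.card X *
        Real.sin (exactAngle X t) ^ 2) with hs
      have h1 : (Fintype.card (Solution P) : ℝ) / Fintype.card X ≤ 1 := by
        rw [div_le_one hN]
        exact_mod_cast card_solution_le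
      have h2 : s ≤ 1 := by
        rw [hs, Real.sqrt_le_one]
        exact mul_le_one₀ h1 (by positivity) (Real.sin_sq_le_one _)
      refine searchBound_amplify_tilted hc _ (Real.arcsin s) _ ?_ (Or.inl le_rfl)
      rw [Real.sin_arcsin (by linarith [Real.sqrt_nonneg ((Fintype.card (Solution P) : ℝ) /
        Fintype.card X * Real.sin (exactAngle X t) ^ 2)]) h2, hs, Real.sq_sqrt (by positivity)]
  refine ((key.run_op_bind (a := exactAngle X t) (f := fun a =>
    amplify (tiltedState X a) (tiltedPredicate P) (exactIterations X t) >>= fun z => check P z.1)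
    (by positivity)).run_op_bind (a := exactIterations X t) (f := fun k =>
      Comp.run (op (exactAngle X t)) >>= fun a =>
        amplify (tiltedState X a) (tiltedPredicate P) k >>= fun z => check P z.1)
    (by positivity)).mono ?_ le_rfl
  have hk := exactIterations_le (X := X) ht htX
  nlinarith [mul_le_mul_of_nonneg_right hk (by positivity : (0 : ℝ) ≤ 2 * c + 6),
    (Nat.cast_nonneg c : (0 : ℝ) ≤ c)]

end Search

theorem two_mul_sqrt_add_inv_sqrt_le {x : ℝ} (hx : 0 ≤ x) :
    2 * √x + 1 / √(x + 1) ≤ 2 * √(x + 1) := by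
  have ha := Real.sq_sqrt hx
  have hb := Real.sq_sqrt (by linarith : 0 ≤ x + 1)
  have hb0 : 0 < √(x + 1) := Real.sqrt_pos.2 (by linarith)
  have : 1 / √(x + 1) ≤ 2 * √(x + 1) - 2 * √x := by
    rw [div_le_iff₀ hb0]
    nlinarith [sq_nonneg (√(x + 1) - √x)]
  linarith

section Search

variable {X : Type} [Fintype X] [Nonempty X] {P : X → Timed Bool}

/-- The costs `√(|X| / t)` are summed by `∑ 1 / √t ≤ 2 √n`; failure is impossible once the true
number of solutions has been tried. -/
theorem searchBound_exactSearches {c : ℕ} (hc : ∀ x, (P x).time ≤ c) {n : ℕ}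
    (hn : n ≤ Fintype.card X) :
    SearchBound P (exactSearches P n) (2 * (5 * c + 18) * √(Fintype.card X : ℝ) * √(n : ℝ))
      (if 0 < Fintype.card (Solution P) ∧ Fintype.card (Solution P) ≤ n then 0 else 1) := by
  induction n with
  | zero =>
    refine searchBound_pure_none.mono (by simp) (le_of_eq ?_)
    rw [if_neg (by omega)]
  | succ n ih =>
    have hn' : ((n + 1 : ℕ) : ℝ) ≤ Fintype.card X := by exact_mod_cast hn
    have hμ1 : 1 ≤ √((Fintype.card X : ℝ) / (n + 1 : ℕ)) := by
      rw [Real.one_le_sqrt, one_le_div (by positivity)]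
      exact hn'
    refine ((ih (by omega)).orElse (searchBound_exactSearch hc (Nat.succ_pos n) hn)
      (by positivity) (by split_ifs <;> simp) (by positivity)).mono ?_ ?_
    · have hdiv : √((Fintype.card X : ℝ) / (n + 1 : ℕ)) =
          √(Fintype.card X : ℝ) * (1 / √((n : ℝ) + 1)) := by
        rw [Real.sqrt_div (by positivity)]
        push_cast
        ring
      have hle : (if 0 < Fintype.card (Solution P) ∧ Fintype.card (Solution P) ≤ n
          then (0 : ℝ) else 1) ≤ 1 := by split_ifs <;> simp
      have h1 := mul_le_mul_of_nonneg_right hle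
        (by positivity : 0 ≤ (5 * c + 17) * √((Fintype.card X : ℝ) / (n + 1 : ℕ)))
      have h2 := mul_le_mul_of_nonneg_left (two_mul_sqrt_add_inv_sqrt_le (Nat.cast_nonneg n))
        (by positivity : 0 ≤ (5 * c + 18) * √(Fintype.card X : ℝ))
      rw [hdiv] at h1 hμ1 ⊢
      push_cast
      linarith
    · rcases Nat.eq_zero_or_pos (Fintype.card (Solution P)) with h0 | h0
      · rw [h0]; simp
      · rcases lt_trichotomy (Fintype.card (Solution P)) (n + 1) with h | h | h
        · rw [if_pos (show _ ∧ _ from ⟨h0, Nat.lt_succ_iff.1 h⟩),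
            if_pos (show _ ∧ _ from ⟨h0, h.le⟩), zero_mul]
        · rw [if_pos h.symm, if_pos (show _ ∧ _ from ⟨h0, h.le⟩), mul_zero]
        · rw [if_neg (by omega), if_neg (by omega), if_neg (by omega), mul_one]

/-- The failure probability of a search with parameter `einv`, up to a constant. -/
def failureBound (P : X → Timed Bool) (einv : ℝ) : ℝ :=
  if 0 < Fintype.card (Solution P) then einv⁻¹ else 1

theorem one_le_ceil_logb {einv : ℝ} (h : 1 < einv) : 1 ≤ ⌈Real.logb 2 einv⌉₊ :=
  Nat.one_le_ceil_iff.2 (Real.logb_pos (by norm_num) h)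

/-- At most `t₀` solutions are caught by the exact searches. With more, `√(|X| / t₀)` is a
sufficient range for random iterations, and since `(3 / 4) ^ 3 ≤ 1 / 2`, all `3 t₀` attempts fail
with probability at most `2 ^ (-t₀) ≤ 1 / einv`. -/
theorem searchBound_bcwz {c : ℕ} (hc : ∀ x, (P x).time ≤ c) {einv : ℝ} (he : 1 < einv) :
    SearchBound P (bcwz P einv)
      ((19 * c + 66) * (√(Fintype.card X : ℝ) * √(⌈Real.logb 2 einv⌉₊ : ℝ)))
      (failureBound P einv) := by
  have hN1 : (1 : ℝ) ≤ Fintype.card X := by exact_mod_cast Fintype.card_pos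
  have ht1 : (1 : ℝ) ≤ ⌈Real.logb 2 einv⌉₊ := by exact_mod_cast one_le_ceil_logb he
  have hpow : einv ≤ 2 ^ ⌈Real.logb 2 einv⌉₊ :=
    le_pow_of_logb_le (by norm_num) (by linarith) (Nat.le_ceil _)
  unfold bcwz
  set t₀ := ⌈Real.logb 2 einv⌉₊ with ht₀
  have hfb0 : 0 ≤ failureBound P einv := by
    unfold failureBound
    split_ifs
    · positivity
    · exact zero_le_one
  have hs1 : 1 ≤ √(Fintype.card X : ℝ) := Real.one_le_sqrt.2 hN1
  have hs2 : 1 ≤ √(t₀ : ℝ) := Real.one_le_sqrt.2 ht1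
  have hq1 := Real.mul_self_sqrt (by linarith : 0 ≤ (Fintype.card X : ℝ))
  have hq2 := Real.mul_self_sqrt (by linarith : 0 ≤ (t₀ : ℝ))
  have hc0 : (0 : ℝ) ≤ c := Nat.cast_nonneg c
  rcases lt_or_ge t₀ (Fintype.card X) with h | h
  · have hm1 : 1 ≤ √((Fintype.card X : ℝ) / t₀) := by
      rw [Real.one_le_sqrt, one_le_div (by positivity)]
      exact_mod_cast h.le
    set m := √((Fintype.card X : ℝ) / t₀) with hm
    have hmt : m * √(t₀ : ℝ) = √(Fintype.card X : ℝ) := by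
      rw [hm, ← Real.sqrt_mul (by positivity), div_mul_cancel₀ _ (by positivity)]
    have hle : √(t₀ : ℝ) ≤ √(Fintype.card X : ℝ) :=
      Real.sqrt_le_sqrt (by exact_mod_cast h.le)
    have hrandom : SearchBound P ((randomGrover P m).retry (3 * t₀))
        ((3 * t₀ : ℕ) * ((3 * c + 8) * m + 1))
        (if Fintype.card (Solution P) ≤ t₀ then 1 else einv⁻¹) := by
      split_ifs with hle
      · exact ((searchBound_randomGrover hc hm1).retry (by positivity) zero_le_one le_rfl _).mono
          le_rfl (by simp)
      · have hcard : (t₀ : ℝ) ≤ Fintype.card (Solution P) := by exact_mod_cast (by omega)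
        refine ((searchBound_randomGrover_of_sqrt_le hc hm1 (by omega) ?_).retry (by positivity)
          (by norm_num) (by norm_num) (3 * t₀)).mono le_rfl ?_
        · exact Real.sqrt_le_sqrt (by gcongr)
        · calc (3 / 4 : ℝ) ^ (3 * t₀) = ((3 / 4) ^ 3) ^ t₀ := by rw [pow_mul]
            _ ≤ (2⁻¹) ^ t₀ := by gcongr; norm_num
            _ = (2 ^ t₀)⁻¹ := by rw [inv_pow]
            _ ≤ einv⁻¹ := by gcongr
    have hexact := searchBound_exactSearches hc (P := P) (n := t₀) h.le
    have hcomb := hexact.orElse hrandom (by positivity) (by split_ifs <;> simp) (by positivity)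
    refine (SearchBound.run_op_bind (a := t₀) (f := fun t₀ : ℕ =>
      (exactSearches P (min t₀ (Fintype.card X))).orElse (if t₀ < Fintype.card X then
        (randomGrover P √((Fintype.card X : ℝ) / t₀)).retry (3 * t₀) else pure none))
      (by rw [if_pos h, min_eq_left h.le]; exact hcomb)
      (add_nonneg (by positivity) (by split_ifs <;> positivity))).mono ?_ ?_
    · have h1 : (if 0 < Fintype.card (Solution P) ∧ Fintype.card (Solution P) ≤ t₀
          then (0 : ℝ) else 1) ≤ 1 := by split_ifs <;> simp
      have h2 := mul_le_mul_of_nonneg_right h1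
        (by positivity : 0 ≤ ((3 * t₀ : ℕ) : ℝ) * ((3 * c + 8) * m + 1))
      have h3 : (t₀ : ℝ) * m = √(Fintype.card X : ℝ) * √(t₀ : ℝ) := by
        calc (t₀ : ℝ) * m = √(t₀ : ℝ) * √(t₀ : ℝ) * m := by rw [hq2]
          _ = _ := by rw [← hmt]; ring
      have h4 : (t₀ : ℝ) ≤ √(Fintype.card X : ℝ) * √(t₀ : ℝ) := by
        nth_rw 1 [← hq2]
        gcongr
      have h5 : ((3 * t₀ : ℕ) : ℝ) * ((3 * c + 8) * m + 1) =
          3 * (3 * c + 8) * (t₀ * m) + 3 * t₀ := by push_cast; ring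
      rw [h5, h3] at h2
      rw [h5, h3]
      have h6 : 1 ≤ √(Fintype.card X : ℝ) * √(t₀ : ℝ) := by nlinarith
      nlinarith
    · unfold failureBound
      have he1 : einv⁻¹ ≤ 1 := inv_le_one_of_one_le₀ he.le
      by_cases h0 : 0 < Fintype.card (Solution P)
      · by_cases h1 : Fintype.card (Solution P) ≤ t₀
        · rw [if_pos ⟨h0, h1⟩, if_pos h0, zero_mul]; positivity
        · rw [if_neg (by omega), if_neg h1, if_pos h0, one_mul]
      · rw [if_neg (by omega), if_pos (by omega), if_neg h0, one_mul]
  · have hexact := searchBound_exactSearches hc (P := P) (n := Fintype.card X) le_rfl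
    have hcomb := hexact.orElse searchBound_pure_none (by positivity) (by split_ifs <;> simp) le_rfl
    refine (SearchBound.run_op_bind (a := t₀) (f := fun t₀ : ℕ =>
      (exactSearches P (min t₀ (Fintype.card X))).orElse (if t₀ < Fintype.card X then
        (randomGrover P √((Fintype.card X : ℝ) / t₀)).retry (3 * t₀) else pure none))
      (by rw [if_neg h.not_gt, min_eq_right h]; exact hcomb) (by positivity)).mono ?_ ?_
    · have hle : √(Fintype.card X : ℝ) ≤ √(t₀ : ℝ) := Real.sqrt_le_sqrt (by exact_mod_cast h)
      have h4 : √(Fintype.card X : ℝ) * √(Fintype.card X : ℝ) ≤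
          √(Fintype.card X : ℝ) * √(t₀ : ℝ) := by gcongr
      have h6 : 1 ≤ √(Fintype.card X : ℝ) * √(t₀ : ℝ) := by nlinarith
      nlinarith
    · unfold failureBound
      by_cases h0 : 0 < Fintype.card (Solution P)
      · rw [if_pos ⟨h0, card_solution_le⟩, if_pos h0, zero_mul]; positivity
      · rw [if_neg (by omega), if_neg h0, one_mul]

theorem searchBound_findsol {c : ℕ} (hc : ∀ x, (P x).time ≤ c) {einv : ℝ} (he : 1 < einv) :
    SearchBound P (findsol P einv)
      ((115 * c + 421) * (√(Fintype.card X : ℝ) * √(⌈Real.logb 2 einv⌉₊ : ℝ))) 1 := by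
  have hN1 : (1 : ℝ) ≤ Fintype.card X := by exact_mod_cast Fintype.card_pos
  have ht1 : (1 : ℝ) ≤ ⌈Real.logb 2 einv⌉₊ := by exact_mod_cast one_le_ceil_logb he
  have he1 : einv⁻¹ ≤ 1 := inv_le_one_of_one_le₀ he.le
  have hs1 := Real.one_le_sqrt.2 hN1
  have hs2 := Real.one_le_sqrt.2 ht1
  have h4 : √(Fintype.card X : ℝ) ≤ √(Fintype.card X : ℝ) * √(⌈Real.logb 2 einv⌉₊ : ℝ) :=
    le_mul_of_one_le_right (by positivity) hs2
  refine (((searchBound_bbht hc).retry (by positivity) zero_le_one le_rfl 2).orElse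
    (searchBound_bcwz hc he) (by positivity) (by positivity) (by positivity)).mono ?_ ?_
  · push_cast
    have hc0 : (0 : ℝ) ≤ c := Nat.cast_nonneg c
    have := mul_le_mul_of_nonneg_left h4 hc0
    linarith
  · unfold failureBound
    split_ifs <;> simp [he1]

/-- Two runs of BBHT fail with probability at most `1 / (4 k ^ 2)` for `k` solutions. This factor is
at most `1 / √k`, so even the expensive fallback contributes only the order `1 / √k` to the time,
and it makes the error summable over `k`. -/
theorem searchBound_findsol_of_pos {c : ℕ} (hc : ∀ x, (P x).time ≤ c) {einv : ℝ} (he : 1 < einv)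
    (ht : 0 < Fintype.card (Solution P)) :
    SearchBound P (findsol P einv)
      ((115 * c + 421) * (√(Fintype.card X : ℝ) * √(⌈Real.logb 2 einv⌉₊ : ℝ)) /
        √(Fintype.card (Solution P) : ℝ))
      (einv⁻¹ * (1 / (4 * (Fintype.card (Solution P) : ℝ) ^ 2))) := by
  have hc0 : (0 : ℝ) ≤ c := Nat.cast_nonneg c
  have hN0 : (0 : ℝ) ≤ Fintype.card X := Nat.cast_nonneg _
  have ht1 : (1 : ℝ) ≤ ⌈Real.logb 2 einv⌉₊ := by exact_mod_cast one_le_ceil_logb he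
  have hk1 : (1 : ℝ) ≤ Fintype.card (Solution P) := by exact_mod_cast ht
  have hkN : (Fintype.card (Solution P) : ℝ) ≤ Fintype.card X := by exact_mod_cast card_solution_le
  have hs2 := Real.one_le_sqrt.2 ht1
  have hsk := Real.one_le_sqrt.2 hk1
  have hsN := Real.sqrt_le_sqrt hkN
  refine (((searchBound_bbht_of_pos hc ht).retry (by positivity) (by positivity) ?_ 2).orElse
    (searchBound_bcwz hc he) (by positivity) (by positivity) (by positivity)).mono ?_ ?_
  · rw [div_le_one (by positivity)]; linarith
  · rw [Real.sqrt_div hN0]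
    set k := (Fintype.card (Solution P) : ℝ)
    set b := √(⌈Real.logb 2 einv⌉₊ : ℝ)
    set n := √(Fintype.card X : ℝ)
    have h1 : n / √k ≤ n * b / √k := by gcongr; exact le_mul_of_one_le_right (by positivity) hs2
    have h2 : 1 ≤ n * b / √k :=
      ((one_le_div (by linarith)).2 hsN).trans h1
    have h3 : (1 / (2 * k)) ^ 2 * ((19 * c + 66) * (n * b)) ≤
        (19 * c + 66) * (n * b / √k) := by
      have : (1 / (2 * k)) ^ 2 ≤ 1 / √k := by
        rw [one_div_pow]
        have : √k ≤ k := by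
          rw [Real.sqrt_le_left (by linarith)]
          nlinarith
        gcongr
        nlinarith
      calc _ ≤ 1 / √k * ((19 * c + 66) * (n * b)) := by gcongr
        _ = _ := by ring
    have h5 : (115 * (c : ℝ) + 421) * (n * b) / √k = (115 * c + 421) * (n * b / √k) := by ring
    rw [h5]
    push_cast
    have := mul_le_mul_of_nonneg_left h1 hc0
    linarith
  · rw [failureBound, if_pos ht, one_div_pow, mul_comm, mul_pow]
    norm_num

end Search

/-! ### The potential argument for minfind -/

theorem two_mul_sqrt_sub_two_le_sum (t : ℕ) :
    2 * √((t : ℝ) + 1) - 2 ≤ ∑ i ∈ Finset.range t, 1 / √((i : ℝ) + 1) := by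
  induction t with
  | zero => simp
  | succ t ih =>
    rw [Finset.sum_range_succ]
    have ha := Real.sq_sqrt (by positivity : 0 ≤ (t : ℝ) + 1)
    have hb := Real.sq_sqrt (by positivity : 0 ≤ (t : ℝ) + 1 + 1)
    have ha0 : 0 < √((t : ℝ) + 1) := by positivity
    have : 2 * √((t : ℝ) + 1 + 1) - 2 * √((t : ℝ) + 1) ≤ 1 / √((t : ℝ) + 1) := by
      rw [le_div_iff₀ ha0]
      nlinarith [sq_nonneg (√((t : ℝ) + 1 + 1) - √((t : ℝ) + 1))]
    push_cast
    linarith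

/-- The mean of the potential `2 - 1 / √(i + 1)` over `i < t` is smaller than its value at `t`, by
a constant fraction of `1 / √(t + 1)`. -/
theorem sum_potential_add_le {t : ℕ} (ht : 0 < t) :
    (∑ i ∈ Finset.range t, (2 - 1 / √((i : ℝ) + 1))) / t + 1 / (6 * √((t : ℝ) + 1)) ≤
      2 - 1 / √((t : ℝ) + 1) := by
  have h := two_mul_sqrt_sub_two_le_sum t
  have ht1 : (1 : ℝ) ≤ t := by exact_mod_cast ht
  rw [Finset.sum_sub_distrib]
  set s := √((t : ℝ) + 1) with hs
  have hs2 : s ^ 2 = t + 1 := Real.sq_sqrt (by positivity)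
  -- The drop `2 / (s + 1) - 1 / s` is at least `1 / (6 s)` exactly when `s ≥ 7 / 5`; `t ≥ 1` gives
  -- `s ≥ √2`.
  have hs7 : 7 / 5 ≤ s := by
    rw [hs]
    exact Real.le_sqrt_of_sq_le (by norm_num; linarith)
  have h1 : (2 * s - 2) / t = 2 / (s + 1) := by
    rw [show (t : ℝ) = (s - 1) * (s + 1) by linarith]
    have : s - 1 ≠ 0 := by linarith
    field_simp
  have h2 : (2 * s - 2) / t ≤ (∑ i ∈ Finset.range t, 1 / √((i : ℝ) + 1)) / t := by gcongr
  rw [h1] at h2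
  have h3 : 1 / s + 1 / (6 * s) ≤ 2 / (s + 1) := by
    have : 1 / s + 1 / (6 * s) = 7 / (6 * s) := by field_simp; norm_num
    rw [this, div_le_div_iff₀ (by positivity) (by positivity)]
    linarith
  simp only [Finset.sum_const, Finset.card_range, nsmul_eq_mul]
  rw [sub_div, mul_div_cancel_left₀ _ (by positivity)]
  linarith

/-- Inserting a maximal element leaves the counts of the others unchanged. Without ties the counts
are `0, 1, 2, …`; ties only lower them. -/
theorem sum_card_filter_lt_le {X R : Type} [DecidableEq X] [LinearOrder R] (f : X → R)
    {U : ℕ → ℝ} (hU : Monotone U) (s : Finset X) :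
    ∑ x ∈ s, U (s.filter fun z => f z < f x).card ≤ ∑ i ∈ Finset.range s.card, U i := by
  induction s using Finset.induction_on_max_value f with
  | empty => simp
  | insert a s ha hmax ih =>
    rw [Finset.sum_insert ha, Finset.card_insert_of_notMem ha, Finset.sum_range_succ, add_comm]
    refine add_le_add ((Finset.sum_le_sum fun x hx => ?_).trans ih) (hU ?_)
    · rw [Finset.filter_insert, if_neg (hmax x hx).not_gt]
    · rw [Finset.filter_insert, if_neg (lt_irrefl _)]
      exact Finset.card_filter_le _ _

section Search

variable {X : Type} [Fintype X] {R : Type} [LinearOrder R]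

theorem solutionMean_le {P : X → Timed Bool} {g : Option (Solution P) → ℝ≥0∞} {b : ℝ≥0∞}
    (h : ∀ x, g (some x) ≤ b) : solutionMean P g ≤ b := by
  unfold solutionMean
  refine ENNReal.div_le_of_le_mul' ?_
  refine (Finset.sum_le_sum fun x _ => h x).trans ?_
  simp

theorem solutionMean_const_add {P : X → Timed Bool} (hP : 0 < Fintype.card (Solution P))
    {g : Option (Solution P) → ℝ≥0∞} (b : ℝ≥0∞) :
    solutionMean P (fun o => b + g o) = b + solutionMean P g := by
  have hP' : (Fintype.card (Solution P) : ℝ≥0∞) ≠ 0 := by exact_mod_cast hP.ne'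
  unfold solutionMean
  rw [Finset.sum_add_distrib, ENNReal.add_div, Finset.sum_const, Finset.card_univ, nsmul_eq_mul,
    mul_comm, ENNReal.mul_div_cancel_right hP' (by simp)]

theorem solutionMean_eq_zero {P : X → Timed Bool} (hP : Fintype.card (Solution P) = 0)
    (g : Option (Solution P) → ℝ≥0∞) : solutionMean P g = 0 := by
  have := Fintype.card_eq_zero_iff.1 hP
  simp [solutionMean]

/-- The number of elements that are better than `y`. -/
def rank (F : X → Timed R) (y : X) : ℕ :=
  (Finset.univ.filter fun x => (F x).val < (F y).val).card

omit [Fintype X] in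
theorem isBetter_iff (F : X → Timed R) (y x : X) :
    (isBetter F y x).val = true ↔ (F x).val < (F y).val := decide_eq_true_iff

theorem card_solution_isBetter (F : X → Timed R) (y : X) :
    Fintype.card (Solution (isBetter F y)) = rank F y := by
  rw [Fintype.card_subtype, rank]
  simp only [isBetter_iff]

theorem rank_lt_rank {F : X → Timed R} {x y : X} (h : (F x).val < (F y).val) :
    rank F x < rank F y := by
  apply Finset.card_lt_card
  rw [Finset.ssubset_iff_of_subset]
  · exact ⟨x, by simpa using h, by simp⟩
  · intro z hz
    simp only [Finset.mem_filter, Finset.mem_univ, true_and] at hz ⊢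
    exact hz.trans h

theorem rank_lt_card (F : X → Timed R) (y : X) : rank F y < Fintype.card X :=
  Finset.card_lt_card (Finset.filter_ssubset.2 ⟨y, Finset.mem_univ y, lt_irrefl _⟩)

theorem sum_rank_le (F : X → Timed R) (y : X) {U : ℕ → ℝ} (hU : Monotone U) :
    ∑ x : Solution (isBetter F y), U (rank F x.1) ≤ ∑ i ∈ Finset.range (rank F y), U i := by
  classical
  have h := sum_card_filter_lt_le (fun x => (F x).val) hU
    (Finset.univ.filter fun x => (F x).val < (F y).val)
  refine le_trans (le_of_eq ?_) h
  rw [Finset.sum_subtype (p := fun x => (isBetter F y x).val = true) _ (by simp [isBetter_iff])]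
  refine Finset.sum_congr rfl fun x _ => ?_
  -- Whatever beats `x` also beats `y`, so the rank of `x` among the solutions is its rank in `X`.
  have hx := (isBetter_iff F y x.1).1 x.2
  rw [Finset.filter_filter, rank]
  congr 2
  ext z
  simp only [Finset.mem_filter, Finset.mem_univ, true_and]
  exact ⟨fun hz => ⟨hz.trans hx, hz⟩, fun hz => hz.2⟩

variable [Nonempty X]

theorem cost_minfindLoop (w : ℝ≥0∞) (F : X → Timed R) (einv : ℝ) (y : X) (g : X → ℝ≥0∞) :
    (minfindLoop F einv y).cost w g = (findsol (isBetter F y) einv).cost w fun o =>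
      w + o.elim (g y) fun x => (minfindLoop F einv x.1).cost w g := by
  rw [minfindLoop, Comp.cost_bind, Comp.cost_tested]
  congr 1
  funext o
  cases o with
  | none => simp only [Option.elim_none]; rw [Comp.cost_pure]
  | some x => rfl

/-- The bound is monotone in the rank, so the successor may be assumed to have rank one less. The
increment `1 / k - 1 / (k + 1)` covers the error `1 / (4 k ^ 2)` of *findsol*. -/
theorem cost_minfindLoop_failure_le {F : X → Timed R} {c : ℕ}
    (hc : ∀ y x, (isBetter F y x).time ≤ c)
    {einv : ℝ} (he : 1 < einv) {B : Set X} (hB : ∀ y ∈ B, 0 < rank F y) (y : X) :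
    (minfindLoop F einv y).cost 0 (B.indicator 1) ≤
      ENNReal.ofReal (einv⁻¹ * (1 - 1 / (rank F y + 1))) := by
  induction h : rank F y using Nat.strong_induction_on generalizing y with
  | _ t ih =>
    subst h
    rw [cost_minfindLoop]
    simp only [zero_add]
    have he0 : 0 < einv := by linarith
    set G : Option (Solution (isBetter F y)) → ℝ≥0∞ := fun o =>
      o.elim (B.indicator 1 y) fun x => (minfindLoop F einv x.1).cost 0 (B.indicator 1) with hG
    rcases Nat.eq_zero_or_pos (rank F y) with h0 | h0
    · have hm := solutionMean_eq_zero (by rw [card_solution_isBetter, h0]) G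
      have hy : y ∉ B := fun hy => (hB y hy).ne' h0
      refine (searchBound_findsol (hc y) he 0 G 0 (by simp [hG, hy])).trans ?_
      simp [hm]
    · have h1 := searchBound_findsol_of_pos (hc y) he (by rwa [card_solution_isBetter]) 0 G 1 (by
        refine le_add_left ?_
        simp only [hG, Option.elim_none]
        exact Set.indicator_le_self' (by simp) y)
      rw [card_solution_isBetter] at h1
      have ht1 : (1 : ℝ) ≤ rank F y := by exact_mod_cast h0
      have h2 : solutionMean _ G ≤ ENNReal.ofReal (einv⁻¹ * (1 - 1 / rank F y)) := by
        refine solutionMean_le fun x => ?_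
        have hlt := rank_lt_rank ((isBetter_iff F y x.1).1 x.2)
        refine (ih _ hlt x.1 rfl).trans (ENNReal.ofReal_le_ofReal ?_)
        have : (rank F x.1 : ℝ) + 1 ≤ rank F y := by exact_mod_cast hlt
        gcongr
      refine h1.trans ?_
      rw [zero_mul, zero_add, mul_one]
      refine (add_le_add_left h2 _).trans ?_
      have h3 : 0 ≤ 1 - 1 / (rank F y : ℝ) := by
        rw [sub_nonneg, div_le_one (by linarith)]
        exact ht1
      rw [← ENNReal.ofReal_add (by positivity) (by positivity), ← mul_add]
      refine ENNReal.ofReal_le_ofReal (mul_le_mul_of_nonneg_left ?_ (by positivity))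
      set k := (rank F y : ℝ)
      have h4 : 1 / k - 1 / (k + 1) = 1 / (k * (k + 1)) := by
        field_simp
        ring
      have h5 : 1 / (4 * k ^ 2) ≤ 1 / (k * (k + 1)) := by
        exact one_div_le_one_div_of_le (by positivity) (by nlinarith)
      linarith

/-- `K` is scaled so that the expected drop `K / (6 √(t + 1))` of the potential covers one *findsol*
call and its test. At rank `0` the potential is `K` itself, enough for the final unsuccessful call.
-/
theorem cost_minfindLoop_time_le {F : X → Timed R} {c : ℕ}
    (hc : ∀ y x, (isBetter F y x).time ≤ c)
    {einv : ℝ} (he : 1 < einv) (y : X) :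
    (minfindLoop F einv y).cost 1 (fun _ => 0) ≤
      ENNReal.ofReal (6 * (230 * c + 843) * (√(Fintype.card X : ℝ) *
        √(⌈Real.logb 2 einv⌉₊ : ℝ)) * (2 - 1 / √((rank F y : ℝ) + 1))) := by
  have ht1 : (1 : ℝ) ≤ ⌈Real.logb 2 einv⌉₊ := by exact_mod_cast one_le_ceil_logb he
  have hs2 := Real.one_le_sqrt.2 ht1
  have hN1 : (1 : ℝ) ≤ Fintype.card X := by exact_mod_cast Fintype.card_pos
  have hs1 := Real.one_le_sqrt.2 hN1
  have hc0 : (0 : ℝ) ≤ c := Nat.cast_nonneg c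
  set b := √(⌈Real.logb 2 einv⌉₊ : ℝ) with hb
  set n := √(Fintype.card X : ℝ) with hn
  have hle : n ≤ n * b := le_mul_of_one_le_right (by positivity) hs2
  set K := 6 * (230 * c + 843) * (n * b) with hK
  have hK0 : 0 ≤ K := by positivity
  have hUmono : Monotone fun i : ℕ => K * (2 - 1 / √((i : ℝ) + 1)) := by
    intro i j hij
    dsimp only
    gcongr
  have hUnonneg : ∀ i : ℕ, 0 ≤ K * (2 - 1 / √((i : ℝ) + 1)) := by
    intro i
    have : 1 / √((i : ℝ) + 1) ≤ 1 := by
      rw [div_le_one (by positivity), Real.one_le_sqrt]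
      linarith [(Nat.cast_nonneg i : (0 : ℝ) ≤ i)]
    exact mul_nonneg hK0 (by linarith)
  induction h : rank F y using Nat.strong_induction_on generalizing y with
  | _ t ih =>
    subst h
    rw [cost_minfindLoop]
    set G : Option (Solution (isBetter F y)) → ℝ≥0∞ := fun o =>
      o.elim 0 fun x => (minfindLoop F einv x.1).cost 1 (fun _ => 0) with hG
    change (findsol (isBetter F y) einv).cost 1 (fun o => 1 + G o) ≤ _
    rcases Nat.eq_zero_or_pos (rank F y) with h0 | h0
    · have hm := solutionMean_eq_zero (by rw [card_solution_isBetter, h0]) fun o => 1 + G o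
      refine (searchBound_findsol (hc y) he 1 (fun o => 1 + G o) 1 (by simp [hG])).trans ?_
      rw [hm, h0, one_mul, add_zero, ENNReal.ofReal_one, one_mul, ← ENNReal.ofReal_one,
        ← ENNReal.ofReal_add (by positivity) zero_le_one]
      refine ENNReal.ofReal_le_ofReal ?_
      simp only [Nat.cast_zero, zero_add, Real.sqrt_one, div_one]
      nlinarith
    · have ht1 : (1 : ℝ) ≤ rank F y := by exact_mod_cast h0
      have hpos : 0 < Fintype.card (Solution (isBetter F y)) := by rwa [card_solution_isBetter]
      -- Excess `0`: a false negative merely ends the loop, so it does not increase the time.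
      have h1 := searchBound_findsol_of_pos (hc y) he hpos 1 (fun o => 1 + G o) 0 (by
        rw [solutionMean_const_add hpos]
        simp [hG])
      rw [solutionMean_const_add hpos, card_solution_isBetter, mul_zero, add_zero, one_mul] at h1
      have h2 : solutionMean _ G ≤ ENNReal.ofReal
          (K * ((∑ i ∈ Finset.range (rank F y), (2 - 1 / √((i : ℝ) + 1))) / rank F y)) := by
        unfold solutionMean
        rw [card_solution_isBetter, ← mul_div_assoc, ENNReal.ofReal_div_of_pos (by linarith),
          ENNReal.ofReal_natCast, Finset.mul_sum]
        gcongr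
        refine le_trans ?_ (ENNReal.ofReal_le_ofReal (sum_rank_le F y hUmono))
        rw [ENNReal.ofReal_sum_of_nonneg fun x _ => hUnonneg _]
        exact Finset.sum_le_sum fun x _ => ih _ (rank_lt_rank ((isBetter_iff F y x.1).1 x.2)) x.1 rfl
      refine h1.trans ?_
      rw [← ENNReal.ofReal_one]
      refine (add_le_add_right (add_le_add_right h2 _) _).trans ?_
      have h4 : 0 ≤ (∑ i ∈ Finset.range (rank F y), (2 - 1 / √((i : ℝ) + 1))) / rank F y := by
        refine div_nonneg (Finset.sum_nonneg fun i _ => ?_) (by linarith)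
        have : 1 / √((i : ℝ) + 1) ≤ 1 := by
          rw [div_le_one (by positivity), Real.one_le_sqrt]
          linarith [(Nat.cast_nonneg i : (0 : ℝ) ≤ i)]
        linarith
      rw [← ENNReal.ofReal_add zero_le_one (by positivity),
        ← ENNReal.ofReal_add (by positivity) (by positivity)]
      refine ENNReal.ofReal_le_ofReal ?_
      have h3 := mul_le_mul_of_nonneg_left (sum_potential_add_le h0) hK0
      have hsq : √((rank F y : ℝ) + 1) ≤ 2 * √(rank F y : ℝ) := by
        rw [Real.sqrt_le_left (by positivity), mul_pow, Real.sq_sqrt (by positivity)]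
        linarith
      have hsn : √((rank F y : ℝ) + 1) ≤ n :=
        Real.sqrt_le_sqrt (by exact_mod_cast rank_lt_card F y)
      set s := √((rank F y : ℝ) + 1) with hs
      have hs0 : 0 < s := by positivity
      -- Passing from `√t` to `√(t + 1)` costs a factor `2`; the remaining unit in `843` pays for
      -- the test step.
      have h5 : (115 * c + 421) * (n * b) / √(rank F y : ℝ) ≤ (230 * c + 842) * (n * b) / s := by
        rw [div_le_div_iff₀ (by positivity) hs0]
        have := mul_le_mul_of_nonneg_left hsq (by positivity : 0 ≤ (115 * c + 421) * (n * b))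
        linarith
      have h6 : 1 ≤ n * b / s := by
        rw [one_le_div hs0]
        exact hsn.trans hle
      have h7 : K * (1 / (6 * s)) = (230 * c + 842) * (n * b) / s + n * b / s := by
        rw [hK]
        field_simp
        ring
      rw [mul_add, h7] at h3
      linarith

/-- *minfind* fails to return a minimum with probability at most `1 / einv`. -/
theorem minfind_failure_le {F : X → Timed R} {c : ℕ}
    (hc : ∀ y x, (isBetter F y x).time ≤ c)
    {einv : ℝ} (he : 1 < einv) {B : Set X} (hB : ∀ y ∈ B, 0 < rank F y) :
    (minfind F einv).cost 0 (B.indicator 1) ≤ ENNReal.ofReal einv⁻¹ := by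
  unfold minfind
  rw [Comp.cost_bind, Comp.cost_draw, zero_mul, zero_add]
  refine PMF.expect_le _ fun y => (cost_minfindLoop_failure_le hc he hB y).trans
    (ENNReal.ofReal_le_ofReal ?_)
  have : 0 ≤ einv⁻¹ := by positivity
  refine mul_le_of_le_one_right this ?_
  rw [sub_le_self_iff]
  positivity

theorem minfind_time_le {F : X → Timed R} {c : ℕ}
    (hc : ∀ y x, (isBetter F y x).time ≤ c)
    {einv : ℝ} (he : 1 < einv) :
    (minfind F einv).cost 1 (fun _ => 0) ≤
      ENNReal.ofReal (1 + 12 * (230 * c + 843) * (√(Fintype.card X : ℝ) *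
        √(⌈Real.logb 2 einv⌉₊ : ℝ))) := by
  unfold minfind
  rw [Comp.cost_bind, Comp.cost_draw, ENNReal.ofReal_add zero_le_one (by positivity)]
  gcongr
  · simp
  refine PMF.expect_le _ fun y => (cost_minfindLoop_time_le hc he y).trans
    (ENNReal.ofReal_le_ofReal ?_)
  have h1 : 2 - 1 / √((rank F y : ℝ) + 1) ≤ 2 := by
    rw [sub_le_self_iff]
    positivity
  have h2 := mul_le_mul_of_nonneg_left h1 (by positivity : 0 ≤ 6 * (230 * (c : ℝ) + 843) *
    (√(Fintype.card X : ℝ) * √(⌈Real.logb 2 einv⌉₊ : ℝ)))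
  linarith

end Search

/-! ### The table of prefix sums and the objective function -/

/-- An invariant and a time bound for a loop over `0, …, N - 1`. -/
theorem foldlM_finRange_spec {β : Type} {N : ℕ} (f : β → Fin N → Timed β) (I : ℕ → β → Prop)
    (c : ℕ)
    (hf : ∀ (i : Fin N) b, I i b → I (i + 1) (f b i).val ∧ (f b i).time ≤ c) {b : β} (hb : I 0 b) :
    I N ((List.finRange N).foldlM f b).val ∧ ((List.finRange N).foldlM f b).time ≤ N * c := by
  -- Generalized to lists of consecutive indices starting at any `k`, so that induction applies to
  -- the tail.
  have key : ∀ (l : List (Fin N)) (k : ℕ) (b : β),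
      (∀ (m : ℕ) (h : m < l.length), (l[m]).val = k + m) → I k b →
      I (k + l.length) (l.foldlM f b).val ∧ (l.foldlM f b).time ≤ l.length * c := by
    intro l
    induction l with
    | nil => exact fun k b _ hk => ⟨hk, Nat.zero_le _⟩
    | cons a l ih =>
      intro k b hl hk
      have ha : a.val = k := hl 0 (Nat.succ_pos _)
      obtain ⟨h1, h2⟩ := hf a b (ha ▸ hk)
      rw [ha] at h1
      obtain ⟨h3, h4⟩ := ih (k + 1) (f b a).val (fun m hm => by
        have := hl (m + 1) (Nat.succ_lt_succ hm)
        rw [List.getElem_cons_succ] at this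
        omega) h1
      rw [List.length_cons, ← Nat.add_assoc, Nat.add_right_comm]
      refine ⟨h3, ?_⟩
      change (f b a).time + (l.foldlM f (f b a).val).time ≤ _
      rw [Nat.add_one_mul]
      omega
  simpa using key (List.finRange N) 0 b (by simp) hb

section Table

variable {N : ℕ} (A : Fin N → Fin N → ℝ)

/-- The sum of the entries with indices at most `p` and `q`. -/
def prefixSum (p q : ℤ) : ℝ :=
  ∑ a : Fin N, ∑ b : Fin N, if (a : ℤ) ≤ p ∧ (b : ℤ) ≤ q then A a b else 0

theorem prefixSum_eq_zero {p q : ℤ} (h : p < 0 ∨ q < 0) : prefixSum A p q = 0 := by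
  unfold prefixSum
  refine Finset.sum_eq_zero fun a _ => Finset.sum_eq_zero fun b _ => if_neg ?_
  omega

/-- Inclusion–exclusion, checked cell by cell once `A i j` is also written as a sum of indicators.
-/
theorem prefixSum_eq (i j : Fin N) :
    prefixSum A i j = A i j + (prefixSum A (i - 1) j + prefixSum A i (j - 1) -
      prefixSum A (i - 1) (j - 1)) := by
  have h : A i j = ∑ a : Fin N, ∑ b : Fin N, if a = i ∧ b = j then A a b else 0 := by
    rw [Finset.sum_eq_single i (fun a _ ha => by simp [ha]) (by simp),
      Finset.sum_eq_single j (fun b _ hb => by simp [hb]) (by simp)]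
    simp
  rw [h]
  unfold prefixSum
  simp only [← Finset.sum_add_distrib, ← Finset.sum_sub_distrib]
  refine Finset.sum_congr rfl fun a _ => Finset.sum_congr rfl fun b _ => ?_
  simp only [Fin.ext_iff]
  split_ifs <;> first | omega | simp

theorem subarraySumOf_eq {miny minx maxy maxx : Fin N} (hy : miny ≤ maxy) (hx : minx ≤ maxx) :
    subarraySumOf A (miny, minx, maxy, maxx) =
      prefixSum A maxy maxx - prefixSum A maxy (minx - 1) - prefixSum A (miny - 1) maxx +
        prefixSum A (miny - 1) (minx - 1) := by
  have hIcc : ∀ (u v : Fin N) (g : Fin N → ℝ), ∑ a ∈ Finset.Icc u v, g a =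
      ∑ a, if u ≤ a ∧ a ≤ v then g a else 0 := fun u v g => by
    rw [← Finset.sum_filter]
    congr 1
    ext
    simp
  unfold subarraySumOf prefixSum
  simp only [hIcc, ← Finset.sum_add_distrib, ← Finset.sum_sub_distrib]
  refine Finset.sum_congr rfl fun a _ => ?_
  have hif : ∀ (p : Prop) [Decidable p] (g : Fin N → ℝ),
      (if p then ∑ b, g b else 0) = ∑ b, if p then g b else 0 := fun p _ g => by
    split_ifs <;> simp
  rw [hif]
  refine Finset.sum_congr rfl fun b _ => ?_
  rw [← ite_and]
  simp only [Fin.le_def] at hy hx ⊢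
  split_ifs <;> first | omega | simp

/-- The table agrees with the prefix sums in the first `i` rows and in `j` cells of the next
one. -/
def TableInvariant (i j : ℕ) (T : ℤ → ℤ → ℝ) : Prop :=
  ∀ p q : ℤ, p < N → q < N → (p < i ∨ q < 0 ∨ (p = i ∧ q < j)) → T p q = prefixSum A p q

theorem fillCell_spec (i j : Fin N) {T : ℤ → ℤ → ℝ} (hT : TableInvariant A i j T) :
    TableInvariant A i (j + 1) (fillCell A i j T).val := by
  intro p q hp hq h
  have hval : (fillCell A i j T).val p q = if p = i ∧ q = j then
      A i j + (T (i - 1) j + T i (j - 1) - T (i - 1) (j - 1)) else T p q := rfl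
  rw [hval]
  split_ifs with hpq
  · obtain ⟨rfl, rfl⟩ := hpq
    rw [prefixSum_eq, hT _ _ (by omega) (by omega) (by omega),
      hT _ _ (by omega) (by omega) (by omega), hT _ _ (by omega) (by omega) (by omega)]
  · exact hT p q hp hq (by omega)

theorem buildTable_spec :
    (∀ p q : ℤ, p < N → q < N → (buildTable A).val p q = prefixSum A p q) ∧
      (buildTable A).time ≤ (N + 1) ^ 2 + N * (N * 11 + 1) := by
  have h := foldlM_finRange_spec (fun (T : ℤ → ℤ → ℝ) (i : Fin N) => (do
      let i ← op i
      (List.finRange N).foldlM (fun T j => do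
        let j ← op j
        fillCell A i j T) T : Timed (ℤ → ℤ → ℝ))) (fun i T => TableInvariant A i 0 T) (N * 11 + 1)
    (fun i T hT => by
      obtain ⟨h1, h2⟩ := foldlM_finRange_spec (fun (T : ℤ → ℤ → ℝ) (j : Fin N) => (do
        let j ← op j
        fillCell A i j T : Timed (ℤ → ℤ → ℝ))) (fun j T => TableInvariant A i j T) 11
        -- Ten operations fill a cell, and one more advances the counter.
        (fun j T hT => ⟨fillCell_spec A i j hT, le_rfl⟩) hT
      refine ⟨fun p q hp hq h => h1 p q hp hq (by push_cast at h; omega), ?_⟩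
      rw [add_comm]
      exact Nat.add_le_add_left h2 1)
    (b := fun _ _ => 0)
    (fun p q _ _ h => (prefixSum_eq_zero A (by push_cast at h; omega)).symm)
  exact ⟨fun p q hp hq => h.1 p q hp hq (Or.inl hp), Nat.add_le_add_left h.2 _⟩

theorem negSum_time_le (T : ℤ → ℤ → ℝ) (r : Limits N) : (negSum T r).time ≤ 13 := by
  obtain ⟨miny, minx, maxy, maxx⟩ := r
  by_cases hy : miny ≤ maxy <;> by_cases hx : minx ≤ maxx
  all_goals
    change 1 + (1 + (1 + Timed.time (if (decide _ && decide _ : Bool) = true then _ else _))) ≤ 13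
    simp only [hy, hx, decide_true, decide_false, Bool.and_true, Bool.and_false,
      Bool.false_eq_true, if_true, if_false]
  all_goals
    first
    | exact (by norm_num : 1 + (1 + (1 + 10)) ≤ 13)
    | exact (by norm_num : 1 + (1 + (1 + 1)) ≤ 13)

theorem isBetter_negSum_time_le (T : ℤ → ℤ → ℝ) (y x : Limits N) :
    (isBetter (negSum T) y x).time ≤ 27 := by
  have h1 := negSum_time_le T x
  have h2 := negSum_time_le T y
  change (negSum T x).time + ((negSum T y).time + 1) ≤ 27
  omega

theorem negSum_val_of_isRectangle {r : Limits N} (hr : IsRectangle r) :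
    (negSum (buildTable A).val r).val = ((-subarraySumOf A r : ℝ) : WithTop ℝ) := by
  obtain ⟨miny, minx, maxy, maxx⟩ := r
  obtain ⟨hy, hx⟩ := hr
  have hT := (buildTable_spec A).1
  rw [subarraySumOf_eq A hy hx, ← hT _ _ (by omega) (by omega), ← hT _ _ (by omega) (by omega),
    ← hT _ _ (by omega) (by omega), ← hT _ _ (by omega) (by omega)]
  change Timed.val (if (decide _ && decide _ : Bool) = true then _ else _) = _
  simp only [hy, hx, decide_true, Bool.and_true, if_true]
  rfl

theorem negSum_val_of_not_isRectangle (T : ℤ → ℤ → ℝ) {r : Limits N} (hr : ¬ IsRectangle r) :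
    (negSum T r).val = ⊤ := by
  obtain ⟨miny, minx, maxy, maxx⟩ := r
  change Timed.val (if (decide _ && decide _ : Bool) = true then _ else _) = _
  rw [if_neg]
  · rfl
  · rw [← Bool.decide_and, decide_eq_true_iff]
    exact hr

theorem isMaxSubarray_of_rank_eq_zero [NeZero N] {r : Limits N}
    (h : rank (negSum (buildTable A).val) r = 0) : IsMaxSubarray A r := by
  have hmin : ∀ r' : Limits N,
      (negSum (buildTable A).val r).val ≤ (negSum (buildTable A).val r').val := by
    intro r'
    by_contra hlt
    rw [rank, Finset.card_eq_zero, Finset.filter_eq_empty_iff] at h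
    exact h (Finset.mem_univ r') (not_le.1 hlt)
  have hr : IsRectangle r := by
    by_contra hr
    -- A single cell is a rectangle with a finite value, so `∞` is never the minimum.
    have h0 := hmin (0, 0, 0, 0)
    rw [negSum_val_of_not_isRectangle _ hr, negSum_val_of_isRectangle A ⟨le_rfl, le_rfl⟩,
      top_le_iff] at h0
    exact WithTop.coe_ne_top h0
  refine ⟨hr, fun r' hr' => ?_⟩
  have h1 := hmin r'
  rw [negSum_val_of_isRectangle A hr, negSum_val_of_isRectangle A hr', WithTop.coe_le_coe] at h1
  linarith

end Table

/-! ### Assembling the bounds for subarray-sum -/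

theorem theorem12 :
    ∃ C : ℝ, 0 < C ∧ ∀ (N : ℕ) [NeZero N] (A : Fin N → Fin N → ℝ) (ε : ℝ), 0 < ε → ε < 1 →
      (subarraySum A ε⁻¹).prob {r | ¬ IsMaxSubarray A r} ≤ ENNReal.ofReal ε ∧
      (subarraySum A ε⁻¹).expectedTime ≤
        ENNReal.ofReal (C * (N : ℝ) ^ 2 * √(max 1 (Real.logb 2 ε⁻¹))) := by
  -- With `c = 27`, minfind contributes `2 * 12 * (230 * 27 + 843) = 169272`, the `2` coming from
  -- rounding up `lg ε⁻¹`; the table and the initial draw add at most `17`.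
  refine ⟨169300, by norm_num, fun N _ A ε hε hε1 => ?_⟩
  have he : 1 < ε⁻¹ := (one_lt_inv₀ hε).2 hε1
  have hc := isBetter_negSum_time_le (N := N) (buildTable A).val
  constructor
  · rw [Comp.prob_eq_cost, subarraySum, Comp.cost_bind, Comp.cost_run, zero_mul, zero_add]
    refine (minfind_failure_le hc he fun y hy => ?_).trans (by rw [inv_inv])
    by_contra h
    exact hy (isMaxSubarray_of_rank_eq_zero A (by omega))
  · rw [Comp.expectedTime_eq_cost, subarraySum, Comp.cost_bind, Comp.cost_run, one_mul]
    refine (add_le_add_right (minfind_time_le hc he) _).trans ?_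
    rw [← ENNReal.ofReal_natCast, ← ENNReal.ofReal_add (by positivity) (by positivity)]
    refine ENNReal.ofReal_le_ofReal ?_
    have htime : ((buildTable A).time : ℝ) ≤ (N + 1) ^ 2 + N * (N * 11 + 1) := by
      exact_mod_cast (buildTable_spec A).2
    have hN1 : (1 : ℝ) ≤ N := by exact_mod_cast NeZero.one_le
    have hcard : √(Fintype.card (Limits N) : ℝ) = (N : ℝ) ^ 2 := by
      have : (Fintype.card (Limits N) : ℝ) = ((N : ℝ) ^ 2) ^ 2 := by
        simp only [Fintype.card_prod, Fintype.card_fin]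
        push_cast
        ring
      rw [this, Real.sqrt_sq (by positivity)]
    set M := max 1 (Real.logb 2 ε⁻¹) with hM
    have hM1 : 1 ≤ M := le_max_left _ _
    have hs1 : 1 ≤ √M := Real.one_le_sqrt.2 hM1
    have hceil : √(⌈Real.logb 2 ε⁻¹⌉₊ : ℝ) ≤ 2 * √M := by
      have h1 := Nat.ceil_lt_add_one (Real.logb_nonneg (by norm_num : (1 : ℝ) < 2) he.le)
      have h2 : Real.logb 2 ε⁻¹ ≤ M := le_max_right _ _
      rw [Real.sqrt_le_left (by positivity), mul_pow, Real.sq_sqrt (by linarith)]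
      linarith
    rw [hcard]
    have h1 := mul_le_mul_of_nonneg_left hceil (by positivity : 0 ≤ (N : ℝ) ^ 2)
    have h2 : (N : ℝ) ^ 2 ≤ N ^ 2 * √M := le_mul_of_one_le_right (by positivity) hs1
    push_cast
    nlinarith

end
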